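/- All manifolds, maps, curves and surfaces are complex analytic. For a manifold $Z$ with a distribution $D$ of rank $n$, its prolongation is the manifold $\mathbb P D=\{(z,\ell): z\in Z,\ \ell\subset D(z)\text{ a line}\}$, with projection $\pi:\mathbb P D\to Z$, endowed with the rank $n$ distribution $D^1(z,\ell)=d\pi_{(z,\ell)}^{-1}(\ell)$. The Monster tower is obtained by starting with $\mathcal P^0(n)=\mathbb C^n$, $\Delta_0=T\mathbb C^n$, and prolonging repeatedly: $(\mathcal P^{k+1}(n),\Delta_{k+1})$ is the prolongation of $(\mathcal P^k(n),\Delta_k)$. For $p\in\mathcal P^k(n)$ write $p_i\in\mathcal P^i(n)$, $i\le k$, for its projections; thus $p_{i+1}=(p_i,\ell)$ with a line $\ell\subset\Delta_i(p_i)$, and $p_1=(p_0,\ell)$ is a line in $\mathbb C^n=T_{p_0}\mathbb C^n$ at $p_0$. The vertical space at a point $p$ of level $k\ge 1$ is $V_k(p)=\ker\big(d(\mathcal P^k(n)\to\mathcal P^{k-1}(n))\big)_p$. Each fiber $F$ of $\mathcal P^{i}(n)\to\mathcal P^{i-1}(n)$, $i\ge1$, has prolongations $\mathcal P^0(F)=F\subset\mathcal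 P^i(n)$ and $\mathcal P^{j+1}(F)=\{(q,\ell): q\in\mathcal P^j(F),\ \ell\subset\Delta_{i+j}(q)\cap T_q\mathcal P^j(F)\}\subset \mathcal P^{i+j+1}(n)$. A critical hyperplane at $p\in\mathcal P^k(n)$ is a subspace $\Delta_k(p)\cap T_p\mathcal P^j(F)$, where $F$ is such a fiber, $i+j=k$ and $p\in\mathcal P^j(F)$. A line in $\Delta_k(p)$ is critical if it lies in a critical hyperplane at $p$, and regular otherwise. For $i\ge 1$ the point $p_i=(p_{i-1},\ell)$ is vertical if $i\ge2$ and $\ell\subset V_{i-1}(p_{i-1})$, and it is regular or critical according to whether $\ell$ is regular or critical. The RVT code of $p\in\mathcal P^k(n)$ is the word $\omega_1\cdots\omega_k$ with $\omega_i=V$ if $p_i$ is vertical, $\omega_i=T$ if $p_i$ is critical but not vertical, and $\omega_i=R$ if $p_i$ is regular; $p$ is of type $R^kV$ if it has level $k+1$ and its code is $R\cdots RV$ with $k$ letters $R$. The prolongation of a non-constant integral curve $\sigma$ of $(Z,D)$ is the curve $\sigma^1(t)=(\sigma(t),\operatorname{span}\sigma'(t))$ in $\mathbb P D$, extended analytically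 to parameter values where $\sigma'=0$; $\gamma^k$ denotes the $k$-fold prolongation of a curve $\gamma$ in $\mathbb C^n$. For $p\in\mathcal P^k(n)$ let $\mathrm{Germ}(p)$ be the set of non-constant curve germs $\gamma$ at $t=0$ in $\mathbb C^n$ such that $\gamma^k(0)=p$, $(\gamma^k)'(0)\neq0$, and $(\gamma^k)'(0)$ spans a regular line in $\Delta_k(p)$. The tangent line of a (possibly singular) non-constant curve germ $\gamma$ is $\lim_{t\to0}\operatorname{span}\gamma'(t)$. **Proposition.** Let $p$ be a point of type $R^kV$ in $\mathcal P^{k+1}(n)$. Then $\mathrm{Germ}(p)$ is non-empty, every $\gamma\in\mathrm{Germ}(p)$ is contained in some smooth surface germ at $p_0$ in $\mathbb C^n$, and there is exactly one partial flag $L\subset\Pi\subset\mathbb C^n=T_{p_0}\mathbb C^n$, with $\dim L=1$ and $\dim\Pi=2$, such that: $L$ is the line $p_1$, and for every $\gamma\in\mathrm{Germ}(p)$, $L$ is the tangent line of $\gamma$ and $\Pi$ is the tangent plane at $p_0$ of every smooth surface germ that contains $\gamma$. In particular $\Pi$ depends neither on the choice of $\gamma\in\mathrm{Germ}(p)$ nor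 on that of the surface. -/

import Mathlib

open Filter Topology
open scoped LinearAlgebra.Projectivization

noncomputable section

/-- The points and the charts of a complex manifold: `coord i` is the coordinate map of the chart
`i`, which is meaningful on the chart domain `dom i`. -/
structure Atlas where
  Pt : Type
  Chart : Type
  Model : Chart → Type
  [instGroup : ∀ i, NormedAddCommGroup (Model i)]
  [instSpace : ∀ i, NormedSpace ℂ (Model i)]
  dom : Chart → Set Pt
  coord : ∀ i, Pt → Model i

namespace Atlas

attribute [instance] Atlas.instGroup Atlas.instSpace

variable (M : Atlas)

/-- The charts around the point `p`. -/
abbrev ChartAt (p : M.Pt) : Type := {i : M.Chart // p ∈ M.dom i}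

open Classical in
/-- The change of coordinates `coord j ∘ (coord i)⁻¹` from the chart `i` to the chart `j`, defined
on the image of `dom i ∩ dom j` (and extended by `0`). -/
def transition (i j : M.Chart) (c : M.Model i) : M.Model j :=
  if h : ∃ q, q ∈ M.dom i ∧ q ∈ M.dom j ∧ M.coord i q = c then M.coord j h.choose else 0

/-- The tangent space at `p`: a tangent vector is a family of coordinate vectors, one for every
chart around `p`, which the differentials of the changes of coordinates map to one another. -/
def Tangent (p : M.Pt) : Submodule ℂ (∀ i : M.ChartAt p, M.Model i.1) where
  carrier := {v | ∀ i j : M.ChartAt p,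
    v j = fderiv ℂ (M.transition i.1 j.1) (M.coord i.1 p) (v i)}
  add_mem' := by
    intro a b ha hb i j
    simp only [Pi.add_apply, map_add]
    rw [ha i j, hb i j]
  zero_mem' := by
    intro i j
    simp
  smul_mem' := by
    intro c a ha i j
    simp only [Pi.smul_apply, map_smul]
    rw [ha i j]

variable {M}

/-- The (germ of the) curve `σ` is analytic at the parameter value `t₀`. -/
def AnalyticCurveAt (σ : ℂ → M.Pt) (t₀ : ℂ) : Prop :=
  ∀ i : M.ChartAt (σ t₀),
    (∀ᶠ t in 𝓝 t₀, σ t ∈ M.dom i.1) ∧ AnalyticAt ℂ (fun t => M.coord i.1 (σ t)) t₀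

/-- The curve `σ` passes at the parameter value `t₀` through `p`, with velocity `v ∈ T_p M`. -/
def HasVelocityAt (σ : ℂ → M.Pt) (t₀ : ℂ) (p : M.Pt) (v : M.Tangent p) : Prop :=
  σ t₀ = p ∧
    ∀ i : M.ChartAt p, HasDerivAt (fun t => M.coord i.1 (σ t)) ((v : ∀ i, M.Model i.1) i) t₀

/-- The tangent space `T_p S` of a submanifold `S`: the velocities at `p` of the analytic curves
in `S` through `p`. -/
def tangentOfSubset (S : Set M.Pt) (p : M.Pt) : Set (M.Tangent p) :=
  {v | ∃ σ : ℂ → M.Pt,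
    AnalyticCurveAt σ 0 ∧ (∀ᶠ t in 𝓝 0, σ t ∈ S) ∧ HasVelocityAt σ 0 p v}

end Atlas

/-- A manifold `Z` with a rank `n` distribution `D = dist`. For each chart, `cof i 0, …,
cof i (n - 1)` are linear functions of the coordinates whose differentials restrict to a coframe
of `D`; they are used for the fibre coordinates on the projectivization of `D`. -/
structure DistManifold (n : ℕ) extends Atlas where
  dist : ∀ p : Pt, Submodule ℂ (toAtlas.Tangent p)
  cof : ∀ i, Fin n → (Model i →ₗ[ℂ] ℂ)

namespace DistManifold

variable {n : ℕ}

/-- A point of the projectivization `ℙ D`: a point `z` and a line `ℓ` in `D(z)`. -/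
structure ProjPt (Z : DistManifold n) where
  base : Z.Pt
  line : ℙ ℂ (Z.dist base)

/-- The line `ℓ` in `D(z)`, as a subspace of `T_z Z`. -/
def lineIn (Z : DistManifold n) {z : Z.Pt} (l : ℙ ℂ (Z.dist z)) :
    Submodule ℂ (Z.toAtlas.Tangent z) :=
  l.submodule.map (Z.dist z).subtype

/-- The homogeneous fibre coordinate `[df_0(ℓ) : … : df_{n-1}(ℓ)]` of `ℓ` over the chart `i`,
computed on a vector spanning `ℓ`. -/
def homCoord (Z : DistManifold n) (q : Z.ProjPt) (i : Z.ChartAt q.base) (b : Fin n) : ℂ :=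
  Z.cof i.1 b ((q.line.rep : Z.toAtlas.Tangent q.base).1 i)

open Classical in
/-- The manifold `ℙ D`. It has a chart `(i, a)` for each chart `i` of `Z` and each `a < n`: its
domain consists of the `(z, ℓ)` over the domain of `i` with `df_a ≠ 0` on `ℓ`, and its coordinates
are those of `z` in the chart `i` together with the affine coordinates `df_b / df_a`, `b ≠ a`. -/
abbrev projAtlas (Z : DistManifold n) : Atlas where
  Pt := Z.ProjPt
  Chart := Z.Chart × Fin n
  Model := fun ia => Z.Model ia.1 × ({b : Fin n // b ≠ ia.2} → ℂ)
  dom := fun ia => {q | ∃ h : q.base ∈ Z.dom ia.1, Z.homCoord q ⟨ia.1, h⟩ ia.2 ≠ 0}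
  coord := fun ia q =>
    (Z.coord ia.1 q.base,
      fun b => if h : q.base ∈ Z.dom ia.1 then
        Z.homCoord q ⟨ia.1, h⟩ b.1 / Z.homCoord q ⟨ia.1, h⟩ ia.2 else 0)

/-- `dπ v = w`, where `π : ℙ D → Z` is the projection, in the charts of `ℙ D` and of `Z` (where
`π` is the projection to the first factor). -/
def ProjectsTo (Z : DistManifold n) (q : Z.ProjPt) (v : Z.projAtlas.Tangent q)
    (w : Z.toAtlas.Tangent q.base) : Prop :=
  ∀ ia : Z.projAtlas.ChartAt q, (v.1 ia).1 = w.1 ⟨ia.1.1, ia.2.1⟩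

/-- The prolongation `(ℙ D, D¹)` of `(Z, D)`, where `D¹(z, ℓ) = dπ⁻¹(ℓ)`. The functions giving the
coframe of `D¹` in the chart `(i, a)` are `f_a` and the affine coordinates `df_b / df_a`,
`b ≠ a`. -/
abbrev prolong (Z : DistManifold n) : DistManifold n where
  toAtlas := Z.projAtlas
  dist := fun q =>
    { carrier := {v | ∃ w ∈ Z.lineIn q.line, Z.ProjectsTo q v w}
      add_mem' := by
        rintro v v' ⟨w, hw, h⟩ ⟨w', hw', h'⟩
        refine ⟨w + w', add_mem hw hw', fun ia => ?_⟩
        have e1 := h ia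
        have e2 := h' ia
        change (v.1 ia).1 + (v'.1 ia).1 = w.1 ⟨ia.1.1, ia.2.1⟩ + w'.1 ⟨ia.1.1, ia.2.1⟩
        rw [e1, e2]
      zero_mem' := ⟨0, zero_mem _, fun _ => rfl⟩
      smul_mem' := by
        rintro c v ⟨w, hw, h⟩
        refine ⟨c • w, Submodule.smul_mem _ c hw, fun ia => ?_⟩
        have e1 := h ia
        change c • (v.1 ia).1 = c • w.1 ⟨ia.1.1, ia.2.1⟩
        rw [e1] }
  cof := fun ia b =>
    if h : b = ia.2 then
      (Z.cof ia.1 ia.2).comp (LinearMap.fst ℂ (Z.Model ia.1) ({b : Fin n // b ≠ ia.2} → ℂ))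
    else
      (LinearMap.proj (⟨b, h⟩ : {b : Fin n // b ≠ ia.2})).comp
        (LinearMap.snd ℂ (Z.Model ia.1) ({b : Fin n // b ≠ ia.2} → ℂ))

/-- The vertical space `ker dπ` at a point of `ℙ D`. -/
def verticalSpace (Z : DistManifold n) (q : Z.ProjPt) : Set (Z.projAtlas.Tangent q) :=
  {v | Z.ProjectsTo q v 0}

/-- For a submanifold `S` of `Z`, the points `(z, ℓ)` of `ℙ D` with `z ∈ S` and `ℓ ⊆ T_z S`, that
is, the lines in `D ∩ TS`. -/
def prolongSubset (Z : DistManifold n) (S : Set Z.Pt) : Set Z.ProjPt :=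
  {q | q.base ∈ S ∧
    (Z.lineIn q.line : Set (Z.toAtlas.Tangent q.base)) ⊆ Atlas.tangentOfSubset S q.base}

/-- Near `t = 0`, the curve `σ` in `ℙ D` is the prolongation of the curve `τ` in `Z`: it lies over
`τ`, one has `σ(t) = (τ(t), span τ'(t))` for `t ≠ 0`, and `σ` is the analytic extension of this curve to
`t = 0`. -/
def IsCurveProlongation (Z : DistManifold n) (τ : ℂ → Z.Pt) (σ : ℂ → Z.ProjPt) : Prop :=
  Atlas.AnalyticCurveAt (M := Z.toAtlas) τ 0 ∧ Atlas.AnalyticCurveAt (M := Z.projAtlas) σ 0 ∧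
    (σ 0).base = τ 0 ∧ ∀ᶠ t in 𝓝[≠] (0 : ℂ), ∃ (v : Z.dist (σ t).base) (hv : v ≠ 0),
      Atlas.HasVelocityAt τ t (σ t).base v.1 ∧ (σ t).line = Projectivization.mk ℂ v hv

end DistManifold

open DistManifold

/-- Complex `n`-space with its tangent bundle as distribution. -/
abbrev affineSpace (n : ℕ) : DistManifold n where
  Pt := Fin n → ℂ
  Chart := Unit
  Model := fun _ => Fin n → ℂ
  dom := fun _ => Set.univ
  coord := fun _ x => x
  dist := fun _ => ⊤
  cof := fun _ b => LinearMap.proj b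

/-- The Monster tower: `monster n k` is `𝒫^k(n)` with its distribution `Δ_k`. -/
def monster (n : ℕ) : ℕ → DistManifold n
  | 0 => affineSpace n
  | k + 1 => (monster n k).prolong

/-- The points of `𝒫^k(n)`. -/
abbrev MPt (n k : ℕ) : Type := (monster n k).Pt

namespace MPt

variable {n : ℕ}

/-- A point of `𝒫^{k+1}(n)` as a pair `(p_k, ℓ)`. -/
abbrev pair {k : ℕ} (p : MPt n (k + 1)) : (monster n k).ProjPt := p

/-- The projection `𝒫^{k+1}(n) → 𝒫^k(n)`. -/
abbrev down {k : ℕ} (p : MPt n (k + 1)) : MPt n k := p.pair.base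

/-- The base point `p_0 ∈ ℂ^n`. -/
def basePoint : ∀ {k : ℕ}, MPt n k → (Fin n → ℂ)
  | 0, p => p
  | _ + 1, p => basePoint p.down

/-- The line in `ℂ^n` which is the second component of a point of `𝒫^1(n)`. -/
def lineOfLevelOne (p : MPt n 1) : Submodule ℂ (Fin n → ℂ) :=
  ((affineSpace n).lineIn (z := p.pair.base) p.pair.line).map
    ((LinearMap.proj (R := ℂ)
      (φ := fun i : (affineSpace n).ChartAt p.pair.base => (affineSpace n).Model i.1)
      ⟨(), trivial⟩).comp
        ((affineSpace n).toAtlas.Tangent p.pair.base).subtype)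

/-- The line in `ℂ^n` given by the projection `p_1 ∈ 𝒫^1(n)` of `p`. -/
def firstLine : ∀ {k : ℕ}, MPt n (k + 1) → Submodule ℂ (Fin n → ℂ)
  | 0, p => lineOfLevelOne p
  | _ + 1, p => firstLine p.down

/-- The members at the various levels of the baby Monsters: the fibres of
`𝒫^{k+1}(n) → 𝒫^k(n)`, and all their successive prolongations. -/
inductive IsBabyMonster (n : ℕ) : ∀ k : ℕ, Set (MPt n k) → Prop
  | fiber {k : ℕ} (q : MPt n k) : IsBabyMonster n (k + 1) {p | p.down = q}
  | prolong {k : ℕ} (S : Set (MPt n k)) :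
      IsBabyMonster n k S → IsBabyMonster n (k + 1) ((monster n k).prolongSubset S)

/-- The critical hyperplanes `Δ_k(p) ∩ T_p S` through `p`, where `S` is a baby Monster
through `p`. -/
def IsCriticalHyperplane {k : ℕ} (p : MPt n k)
    (H : Set ((monster n k).toAtlas.Tangent p)) : Prop :=
  ∃ S : Set (MPt n k), IsBabyMonster n k S ∧ p ∈ S ∧
    H = ((monster n k).dist p : Set ((monster n k).toAtlas.Tangent p)) ∩
      Atlas.tangentOfSubset S p

/-- A direction in `Δ_k(p)` is critical if it lies in a critical hyperplane, regular if not. -/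
def IsCriticalDirection {k : ℕ} (p : MPt n k) (l : ℙ ℂ ((monster n k).dist p)) : Prop :=
  ∃ H, IsCriticalHyperplane p H ∧
    ((monster n k).lineIn l : Set ((monster n k).toAtlas.Tangent p)) ⊆ H

/-- A point is critical if the corresponding line one level down is critical. -/
def IsCritical {k : ℕ} (p : MPt n (k + 1)) : Prop :=
  IsCriticalDirection p.pair.base p.pair.line

/-- A point is vertical if its level is at least `2` and the corresponding line one level down is
vertical. -/
def IsVertical : ∀ {k : ℕ}, MPt n (k + 1) → Prop
  | 0, _ => False
  | k + 1, p =>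
    ((monster n (k + 1)).lineIn p.pair.line :
      Set ((monster n (k + 1)).toAtlas.Tangent p.pair.base)) ⊆
      (monster n k).verticalSpace p.down.pair

end MPt

/-- The letters of the RVT code: regular, vertical, tangency. -/
inductive RVT
  | R
  | V
  | T

namespace MPt

variable {n : ℕ}

open Classical in
/-- The last letter of the RVT code of a point of positive level. -/
def lastLetter {k : ℕ} (p : MPt n (k + 1)) : RVT :=
  if IsVertical p then RVT.V else if IsCritical p then RVT.T else RVT.R

/-- The RVT code `ω_1 ⋯ ω_k` of a point of level `k`. -/
def code : ∀ {k : ℕ}, MPt n k → List RVT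
  | 0, _ => []
  | _ + 1, p => code p.down ++ [lastLetter p]

/-- Near `t = 0`, the curve `σ` is the `k`-th prolongation `γ^k` of the curve `γ` in `ℂ^n`. -/
def IsIteratedProlongation (γ : ℂ → (Fin n → ℂ)) : ∀ k : ℕ, (ℂ → MPt n k) → Prop
  | 0, σ => σ = γ
  | k + 1, σ => ∃ τ : ℂ → MPt n k,
      IsIteratedProlongation γ k τ ∧ (monster n k).IsCurveProlongation τ σ

/-- `Germ(p)`: the non-constant analytic curve germs `γ` at `t = 0` in `ℂ^n` whose `k`-th
prolongation passes at `t = 0` through `p`, is immersed there, and is tangent to a regular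
direction. -/
def Germ {k : ℕ} (p : MPt n k) : Set (ℂ → (Fin n → ℂ)) :=
  {γ | AnalyticAt ℂ γ 0 ∧ (¬ ∀ᶠ t in 𝓝 0, γ t = γ 0) ∧
    ∃ σ : ℂ → MPt n k, IsIteratedProlongation γ k σ ∧
      ∃ (v : (monster n k).dist p) (hv : v ≠ 0),
        Atlas.HasVelocityAt σ 0 p v.1 ∧
        ¬ IsCriticalDirection p (Projectivization.mk ℂ v hv)}

end MPt

/-- `L` is the tangent line at `t = 0` of the (possibly singular) curve germ `γ` in `ℂ^n`, that
is, the limit of the lines spanned by `γ'(t)` as `t → 0`, `t ≠ 0`. -/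
def IsTangentLine {n : ℕ} (γ : ℂ → (Fin n → ℂ)) (L : Submodule ℂ (Fin n → ℂ)) : Prop :=
  ∃ v : Fin n → ℂ, v ≠ 0 ∧ L = Submodule.span ℂ {v} ∧
    ∃ c : ℂ → ℂ, Tendsto (fun t => c t • deriv γ t) (𝓝[≠] 0) (𝓝 v)

/-- The set `S` is, near `x`, a smooth (analytic) surface through `x` with tangent plane `P` at
`x`: near `x` it is the image of an analytic immersion germ `(ℂ², 0) → (ℂ^n, x)` whose
differential at `0` has range `P`. -/
def IsSmoothSurfaceAt {n : ℕ} (S : Set (Fin n → ℂ)) (x : Fin n → ℂ)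
    (P : Submodule ℂ (Fin n → ℂ)) : Prop :=
  ∃ φ : ℂ × ℂ → (Fin n → ℂ), AnalyticAt ℂ φ 0 ∧ φ 0 = x ∧
    Function.Injective (fderiv ℂ φ 0) ∧ (fderiv ℂ φ 0).range = P ∧
    (∃ U ∈ 𝓝 (0 : ℂ × ℂ), φ '' U ⊆ S) ∧ (∀ U ∈ 𝓝 (0 : ℂ × ℂ), φ '' U ∈ 𝓝[S] x)

end

open Filter Topology
open scoped LinearAlgebra.Projectivization

/-! Let k be the number of letters R in the code; k ≥ 1, since the first letter of a code is never
V. Over a point with code R^k one component x_a serves as independent variable on all levels, the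
other fibre coordinates being the derivatives d^j x_c/dx_a^j (`exists_inDiag`). At the vertical
point p the line has dx_a = 0, so it is a direction e in the space of k-th derivatives, with e_a = 0
and e_b = 1 for some b. Only the vertical hyperplane and the one coming from the once prolonged
fibre are critical at p, because a deeper one would make p_k critical (`isCriticalDirection_iff`). A
germ in Germ(p) avoids both. Hence the k-th derivative X_k of γ with respect to x_a has as velocity
at 0 a non-zero multiple of e, and x_a has a nondegenerate critical point along γ
(`exists_isJetCurve`).

Choose a parameter with x_a = x_a(0) + s². Then dX_j/ds = 2s X_{j+1}, the odd part of X_k starts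
with a multiple of s e, and each integration against 2s ds raises the order of the odd part by two.
So γ = p_0 + s² g(s²) + s^{2k+1} h(s²), where g(0) = w spans p_1, w_a = 1, and h(0) is a non-zero
multiple of e (`exists_odd_part`, `exists_normal_form`). As w and e are independent, (u, v) ↦ p_0 +
u g(u) + v h(u) is an immersion, and its image contains γ. Conversely, on any smooth surface
containing γ the rescaled secants from γ(0) to γ(s) and from γ(-s) to γ(s) converge to w and to a
multiple of e, so the tangent plane is span(w, e) (`mem_of_tendsto_secant`). Both vectors are read
off from p alone.

Integrating J + s e repeatedly against 2s ds, where J is the vector of k-th derivatives at p_k,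
gives a polynomial germ in Germ(p) (`germ_nonempty`); uniqueness of the flag relies on it. -/

section

variable {n : ℕ}

/-! ### Manifolds given by charts, and tangent vectors read in one chart -/

namespace Atlas

/-- The charts of `M` are bijections onto their models, with open overlaps and analytic changes of
coordinates. -/
structure IsManifold (M : Atlas) : Prop where
  finiteDimensional : ∀ i, FiniteDimensional ℂ (M.Model i)
  bijOn : ∀ i, Set.BijOn (M.coord i) (M.dom i) Set.univ
  isOpen_overlap : ∀ i j, IsOpen (M.coord i '' (M.dom i ∩ M.dom j))
  analyticAt_transition : ∀ {i j p}, p ∈ M.dom i → p ∈ M.dom j →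
    AnalyticAt ℂ (M.transition i j) (M.coord i p)

namespace IsManifold

variable {M : Atlas} (hM : M.IsManifold)
include hM

theorem transition_coord {i j : M.Chart} {p : M.Pt} (hi : p ∈ M.dom i) (hj : p ∈ M.dom j) :
    M.transition i j (M.coord i p) = M.coord j p := by
  have h : ∃ q, q ∈ M.dom i ∧ q ∈ M.dom j ∧ M.coord i q = M.coord i p := ⟨p, hi, hj, rfl⟩
  have e : h.choose = p :=
    (hM.bijOn i).injOn h.choose_spec.1 hi h.choose_spec.2.2
  rw [transition, dif_pos h, e]

theorem coord_surj (i : M.Chart) (c : M.Model i) : ∃ p ∈ M.dom i, M.coord i p = c :=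
  (hM.bijOn i).surjOn (Set.mem_univ c)

theorem mem_dom_of_coord_mem {i j : M.Chart} {q : M.Pt} (hi : q ∈ M.dom i)
    (h : M.coord i q ∈ M.coord i '' (M.dom i ∩ M.dom j)) : q ∈ M.dom j := by
  obtain ⟨q', ⟨h1, h2⟩, e⟩ := h
  rwa [← (hM.bijOn i).injOn h1 hi e]

theorem overlap_mem_nhds {i j : M.Chart} {p : M.Pt} (hi : p ∈ M.dom i) (hj : p ∈ M.dom j) :
    M.coord i '' (M.dom i ∩ M.dom j) ∈ 𝓝 (M.coord i p) :=
  (hM.isOpen_overlap i j).mem_nhds ⟨p, ⟨hi, hj⟩, rfl⟩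

/-- `M.Pt` carries no topology: staying in a second chart domain is deduced from the openness of the
overlap in the coordinates of the first chart. -/
theorem eventually_mem_dom {α : Type*} {l : Filter α} {σ : α → M.Pt} {i j : M.Chart} {p : M.Pt}
    (hi : p ∈ M.dom i) (hj : p ∈ M.dom j) (hev : ∀ᶠ t in l, σ t ∈ M.dom i)
    (hc : Tendsto (fun t => M.coord i (σ t)) l (𝓝 (M.coord i p))) :
    ∀ᶠ t in l, σ t ∈ M.dom j := by
  filter_upwards [hev, hc (hM.overlap_mem_nhds hi hj)] with t h1 h2
  exact hM.mem_dom_of_coord_mem h1 h2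

theorem transition_self (i : M.Chart) : M.transition i i = id := by
  funext c
  obtain ⟨p, hp, rfl⟩ := hM.coord_surj i c
  exact hM.transition_coord hp hp

theorem transition_comp {i j k : M.Chart} {p : M.Pt} (hi : p ∈ M.dom i) (hj : p ∈ M.dom j)
    (hk : p ∈ M.dom k) :
    M.transition j k ∘ M.transition i j =ᶠ[𝓝 (M.coord i p)] M.transition i k := by
  filter_upwards [hM.overlap_mem_nhds hi hj, hM.overlap_mem_nhds hi hk] with c hc hc'
  obtain ⟨q, ⟨h1, h2⟩, rfl⟩ := hc
  have h3 := hM.mem_dom_of_coord_mem h1 hc'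
  rw [Function.comp_apply, hM.transition_coord h1 h2, hM.transition_coord h2 h3,
    hM.transition_coord h1 h3]

theorem hasFDerivAt_transition {i j : M.Chart} {p : M.Pt} (hi : p ∈ M.dom i) (hj : p ∈ M.dom j) :
    HasFDerivAt (M.transition i j) (fderiv ℂ (M.transition i j) (M.coord i p)) (M.coord i p) :=
  (hM.analyticAt_transition hi hj).differentiableAt.hasFDerivAt

/-- Chain rule for the cocycle of coordinate changes; it makes the family built from a single
coordinate vector in `tangentOf` compatible. -/
theorem fderiv_transition_comp {i j k : M.Chart} {p : M.Pt} (hi : p ∈ M.dom i)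
    (hj : p ∈ M.dom j) (hk : p ∈ M.dom k) (u : M.Model i) :
    fderiv ℂ (M.transition j k) (M.coord j p) (fderiv ℂ (M.transition i j) (M.coord i p) u) =
      fderiv ℂ (M.transition i k) (M.coord i p) u := by
  have h1 := hM.hasFDerivAt_transition hj hk
  rw [← hM.transition_coord hi hj] at h1
  have h2 := (h1.comp _ (hM.hasFDerivAt_transition hi hj)).congr_of_eventuallyEq
    (hM.transition_comp hi hj hk).symm
  rw [h2.fderiv, hM.transition_coord hi hj]
  rfl

/-- The tangent vector with coordinate vector `u` in the chart `i`. -/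
noncomputable def tangentOf {i : M.Chart} {p : M.Pt} (hi : p ∈ M.dom i) (u : M.Model i) : M.Tangent p :=
  ⟨fun j => fderiv ℂ (M.transition i j.1) (M.coord i p) u,
    fun j k => (hM.fderiv_transition_comp hi j.2 k.2 u).symm⟩

theorem tangentOf_apply {i : M.Chart} {p : M.Pt} (hi : p ∈ M.dom i) (u : M.Model i) :
    (hM.tangentOf hi u).1 ⟨i, hi⟩ = u := by
  change fderiv ℂ (M.transition i i) (M.coord i p) u = u
  rw [hM.transition_self, fderiv_id]
  rfl

omit hM in
theorem tangent_apply {i j : M.Chart} {p : M.Pt} (hi : p ∈ M.dom i) (hj : p ∈ M.dom j)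
    (v : M.Tangent p) :
    v.1 ⟨j, hj⟩ = fderiv ℂ (M.transition i j) (M.coord i p) (v.1 ⟨i, hi⟩) :=
  v.2 ⟨i, hi⟩ ⟨j, hj⟩

omit hM in
theorem tangent_ext {i : M.Chart} {p : M.Pt} (hi : p ∈ M.dom i) {v w : M.Tangent p}
    (h : v.1 ⟨i, hi⟩ = w.1 ⟨i, hi⟩) : v = w := by
  apply Subtype.ext
  funext j
  rw [tangent_apply hi j.2 v, tangent_apply hi j.2 w, h]

theorem eventually_coord_eq {σ : ℂ → M.Pt} {t₀ : ℂ} {i j : M.Chart}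
    (hi : σ t₀ ∈ M.dom i) (hj : σ t₀ ∈ M.dom j) (hev : ∀ᶠ t in 𝓝 t₀, σ t ∈ M.dom i)
    (hc : ContinuousAt (fun t => M.coord i (σ t)) t₀) :
    (fun t => M.coord j (σ t)) =ᶠ[𝓝 t₀] fun t => M.transition i j (M.coord i (σ t)) := by
  filter_upwards [hev, hM.eventually_mem_dom hi hj hev hc] with t h1 h2
  exact (hM.transition_coord h1 h2).symm

theorem hasVelocityAt_of_chart {σ : ℂ → M.Pt} {t₀ : ℂ} {p : M.Pt} {i : M.Chart}
    (hi : p ∈ M.dom i) (h0 : σ t₀ = p) (hev : ∀ᶠ t in 𝓝 t₀, σ t ∈ M.dom i) {v : M.Tangent p}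
    (hd : HasDerivAt (fun t => M.coord i (σ t)) (v.1 ⟨i, hi⟩) t₀) :
    HasVelocityAt σ t₀ p v := by
  subst h0
  refine ⟨rfl, fun j => ?_⟩
  have h2 := ((hM.hasFDerivAt_transition hi j.2).comp_hasDerivAt t₀ hd).congr_of_eventuallyEq
    (hM.eventually_coord_eq hi j.2 hev hd.continuousAt)
  rwa [tangent_apply hi j.2 v]

theorem analyticCurveAt_of_chart {σ : ℂ → M.Pt} {t₀ : ℂ} {i : M.Chart}
    (hi : σ t₀ ∈ M.dom i) (hev : ∀ᶠ t in 𝓝 t₀, σ t ∈ M.dom i)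
    (ha : AnalyticAt ℂ (fun t => M.coord i (σ t)) t₀) : AnalyticCurveAt σ t₀ := by
  intro j
  refine ⟨hM.eventually_mem_dom hi j.2 hev ha.continuousAt, ?_⟩
  refine AnalyticAt.congr ?_ (hM.eventually_coord_eq hi j.2 hev ha.continuousAt).symm
  exact (hM.analyticAt_transition hi j.2).fun_comp (f := fun t => M.coord i (σ t)) ha

end IsManifold

end Atlas

/-! ### Framed distributions and the manifold structure of ℙ D -/

/-- The vector with `a`-th component `1` and the other components `u`. -/
def affineLift {n : ℕ} (a : Fin n) (u : {b : Fin n // b ≠ a} → ℂ) : Fin n → ℂ :=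
  fun b => if h : b = a then 1 else u ⟨b, h⟩

@[simp] theorem affineLift_self (a : Fin n) (u : {b : Fin n // b ≠ a} → ℂ) :
    affineLift a u a = 1 := by simp [affineLift]

theorem affineLift_of_ne {a b : Fin n} (h : b ≠ a) (u : {b : Fin n // b ≠ a} → ℂ) :
    affineLift a u b = u ⟨b, h⟩ := by simp [affineLift, h]

theorem analyticAt_affineLift (a : Fin n) (u : {b : Fin n // b ≠ a} → ℂ) :
    AnalyticAt ℂ (affineLift a) u := by
  rw [analyticAt_pi_iff]
  intro b
  by_cases h : b = a
  · subst h
    simpa using analyticAt_const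
  · simp only [affineLift_of_ne h]
    exact (ContinuousLinearMap.proj (R := ℂ) (φ := fun _ => ℂ)
      (⟨b, h⟩ : {b : Fin n // b ≠ a})).analyticAt u

namespace DistManifold

/-- In each chart, the distribution is parametrized by `ℂ^n`, inversely to the coframe. -/
structure Frame (Z : DistManifold n) where
  isManifold : Z.toAtlas.IsManifold
  E : ∀ i, Z.Model i → (Fin n → ℂ) →ₗ[ℂ] Z.Model i
  analyticAt_E : ∀ i y, AnalyticAt ℂ (fun y : Z.Model i × (Fin n → ℂ) => E i y.1 y.2) y
  cof_E : ∀ i x w b, Z.cof i b (E i x w) = w b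
  mem_dist : ∀ {i p} (hp : p ∈ Z.dom i) (v : Z.toAtlas.Tangent p),
    v ∈ Z.dist p ↔ ∃ w, v.1 ⟨i, hp⟩ = E i (Z.coord i p) w

namespace Frame

variable {Z : DistManifold n} (Φ : Z.Frame)
include Φ

theorem eq_E_cof {i p} (hp : p ∈ Z.dom i) {v : Z.toAtlas.Tangent p} (hv : v ∈ Z.dist p) :
    v.1 ⟨i, hp⟩ = Φ.E i (Z.coord i p) (fun b => Z.cof i b (v.1 ⟨i, hp⟩)) := by
  obtain ⟨w, hw⟩ := (Φ.mem_dist hp v).1 hv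
  rw [hw]
  simp only [Φ.cof_E]

theorem exists_dist {i p} (hp : p ∈ Z.dom i) (w : Fin n → ℂ) :
    ∃ v : Z.dist p, v.1.1 ⟨i, hp⟩ = Φ.E i (Z.coord i p) w :=
  ⟨⟨Φ.isManifold.tangentOf hp (Φ.E i (Z.coord i p) w),
    (Φ.mem_dist hp _).2 ⟨w, Φ.isManifold.tangentOf_apply hp _⟩⟩, Φ.isManifold.tangentOf_apply hp _⟩

theorem dist_ext {i p} (hp : p ∈ Z.dom i) {v v' : Z.dist p}
    (h : ∀ b, Z.cof i b (v.1.1 ⟨i, hp⟩) = Z.cof i b (v'.1.1 ⟨i, hp⟩)) : v = v' := by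
  apply Subtype.ext
  apply Atlas.IsManifold.tangent_ext hp
  rw [Φ.eq_E_cof hp v.2, Φ.eq_E_cof hp v'.2]
  simp only [h]

/-- The coframe separates the vectors of the distribution, so it cannot vanish on a spanning vector.
Hence the charts of ℙ D over a chart around z cover the fibre over z. -/
theorem homCoord_ne_zero (q : Z.ProjPt) (i : Z.toAtlas.ChartAt q.base) :
    ∃ a, Z.homCoord q i a ≠ 0 := by
  by_contra! h
  apply q.line.rep_nonzero
  apply Φ.dist_ext i.2
  intro b
  simpa [homCoord] using h b

end Frame

/-- `homCoord` uses a chosen representative; another spanning vector changes it by a non-zero factor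
only, so vanishing and ratios can be computed on any spanning vector. -/
theorem homCoord_mk {Z : DistManifold n} (q : Z.ProjPt) {v : Z.dist q.base} {hv : v ≠ 0}
    (h : q.line = Projectivization.mk ℂ v hv) (i : Z.toAtlas.ChartAt q.base) :
    ∃ c : ℂ, c ≠ 0 ∧ ∀ b, Z.homCoord q i b = c * Z.cof i.1 b (v.1.1 i) := by
  obtain ⟨c, hc⟩ := Projectivization.exists_smul_eq_mk_rep ℂ v hv
  refine ⟨c, c.ne_zero, fun b => ?_⟩
  rw [homCoord, h, ← hc]
  change Z.cof i.1 b ((c : ℂ) • v.1.1 i) = _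
  rw [map_smul, smul_eq_mul]

theorem homCoord_ne_iff {Z : DistManifold n} (q : Z.ProjPt) {v : Z.dist q.base} {hv : v ≠ 0}
    (h : q.line = Projectivization.mk ℂ v hv) (i : Z.toAtlas.ChartAt q.base) (b : Fin n) :
    Z.homCoord q i b ≠ 0 ↔ Z.cof i.1 b (v.1.1 i) ≠ 0 := by
  obtain ⟨c, hc, e⟩ := homCoord_mk q h i
  rw [e, mul_ne_zero_iff, and_iff_right hc]

theorem homCoord_eq_zero_iff {Z : DistManifold n} (q : Z.ProjPt) {v : Z.dist q.base} {hv : v ≠ 0}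
    (h : q.line = Projectivization.mk ℂ v hv) (i : Z.toAtlas.ChartAt q.base) (b : Fin n) :
    Z.homCoord q i b = 0 ↔ Z.cof i.1 b (v.1.1 i) = 0 :=
  not_iff_not.1 (homCoord_ne_iff q h i b)

theorem exists_line_eq_mk {Z : DistManifold n} (q : Z.ProjPt) :
    ∃ (v : Z.dist q.base) (hv : v ≠ 0), q.line = Projectivization.mk ℂ v hv :=
  ⟨_, q.line.rep_nonzero, q.line.mk_rep.symm⟩

theorem coord_snd {Z : DistManifold n} {q : Z.ProjPt} {i a} (hq : q.base ∈ Z.dom i)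
    (b : {b : Fin n // b ≠ a}) :
    (Z.projAtlas.coord (i, a) q).2 b = Z.homCoord q ⟨i, hq⟩ b.1 / Z.homCoord q ⟨i, hq⟩ a := by
  simp [hq]

theorem affineLift_coord {Z : DistManifold n} {q : Z.ProjPt} {i a}
    (hq : q ∈ Z.projAtlas.dom (i, a)) (b : Fin n) :
    affineLift a (Z.projAtlas.coord (i, a) q).2 b =
      Z.homCoord q ⟨i, hq.1⟩ b / Z.homCoord q ⟨i, hq.1⟩ a := by
  by_cases h : b = a
  · subst h
    rw [affineLift_self, div_self hq.2]
  · rw [affineLift_of_ne h, coord_snd hq.1]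

theorem affineLift_coord_mk {Z : DistManifold n} {q : Z.ProjPt} {i a}
    (hq : q ∈ Z.projAtlas.dom (i, a)) {v : Z.dist q.base} {hv : v ≠ 0}
    (h : q.line = Projectivization.mk ℂ v hv) (b : Fin n) :
    affineLift a (Z.projAtlas.coord (i, a) q).2 b =
      Z.cof i b (v.1.1 ⟨i, hq.1⟩) / Z.cof i a (v.1.1 ⟨i, hq.1⟩) := by
  obtain ⟨c, hc, e⟩ := homCoord_mk q h ⟨i, hq.1⟩
  rw [affineLift_coord hq, e, e, mul_div_mul_left _ _ hc]

namespace Frame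

variable {Z : DistManifold n} (Φ : Z.Frame)
include Φ

/-- A spanning vector of the line `ℓ` with prescribed coordinates. -/
theorem exists_mk_eq {q : Z.ProjPt} {i a} (hq : q ∈ Z.projAtlas.dom (i, a)) :
    ∃ (v : Z.dist q.base) (hv : v ≠ 0), q.line = Projectivization.mk ℂ v hv ∧
      v.1.1 ⟨i, hq.1⟩ = Φ.E i (Z.coord i q.base) (affineLift a (Z.projAtlas.coord (i, a) q).2) := by
  refine ⟨(Z.homCoord q ⟨i, hq.1⟩ a)⁻¹ • q.line.rep,
    smul_ne_zero (inv_ne_zero hq.2) q.line.rep_nonzero, ?_, ?_⟩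
  · conv_lhs => rw [← q.line.mk_rep]
    rw [Projectivization.mk_eq_mk_iff']
    exact ⟨Z.homCoord q ⟨i, hq.1⟩ a, by rw [smul_smul, mul_inv_cancel₀ hq.2, one_smul]⟩
  · rw [Φ.eq_E_cof hq.1 (Subtype.mem _)]
    congr 1
    funext b
    change Z.cof i b ((Z.homCoord q ⟨i, hq.1⟩ a)⁻¹ •
      (q.line.rep : Z.toAtlas.Tangent q.base).1 ⟨i, hq.1⟩) = _
    rw [map_smul, affineLift_coord hq, smul_eq_mul, div_eq_inv_mul]
    rfl

theorem proj_ext {q q' : Z.ProjPt} {i a} (hq : q ∈ Z.projAtlas.dom (i, a))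
    (hq' : q' ∈ Z.projAtlas.dom (i, a))
    (h : Z.projAtlas.coord (i, a) q = Z.projAtlas.coord (i, a) q') : q = q' := by
  obtain ⟨v, hv, e, ev⟩ := Φ.exists_mk_eq hq
  obtain ⟨v', hv', e', ev'⟩ := Φ.exists_mk_eq hq'
  have hb : q.base = q'.base :=
    (Φ.isManifold.bijOn i).injOn hq.1 hq'.1 (congrArg Prod.fst h)
  rw [← h] at ev'
  obtain ⟨z, l⟩ := q
  obtain ⟨z', l'⟩ := q'
  obtain rfl : z = z' := hb
  have : v = v' := Subtype.ext (Atlas.IsManifold.tangent_ext hq.1 (ev.trans ev'.symm))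
  subst this
  obtain rfl : l = l' := e.trans e'.symm
  rfl

/-- The point of `ℙ D` with the coordinates `(x, u)` in the chart `(i, a)`. -/
theorem exists_proj {i} (a : Fin n) {z : Z.Pt} (hz : z ∈ Z.dom i) (u : {b : Fin n // b ≠ a} → ℂ) :
    ∃ q ∈ Z.projAtlas.dom (i, a), q.base = z ∧
      Z.projAtlas.coord (i, a) q = (Z.coord i z, u) := by
  obtain ⟨v, hv⟩ := Φ.exists_dist hz (affineLift a u)
  have hc : ∀ b, Z.cof i b (v.1.1 ⟨i, hz⟩) = affineLift a u b := fun b => by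
    rw [hv, Φ.cof_E]
  have hv0 : v ≠ 0 := by
    rintro rfl
    have := hc a
    rw [affineLift_self] at this
    exact zero_ne_one ((map_zero (Z.cof i a)).symm.trans this)
  have hq : (⟨z, Projectivization.mk ℂ v hv0⟩ : Z.ProjPt) ∈ Z.projAtlas.dom (i, a) :=
    ⟨hz, (homCoord_ne_iff _ rfl _ _).2 (by rw [hc, affineLift_self]; exact one_ne_zero)⟩
  refine ⟨_, hq, rfl, Prod.ext rfl ?_⟩
  funext b
  have := affineLift_coord_mk hq rfl b.1
  rw [hc, hc, affineLift_self, div_one, affineLift_of_ne b.2, affineLift_of_ne b.2] at this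
  exact this

end Frame

end DistManifold

namespace DistManifold

namespace Frame

variable {Z : DistManifold n} (Φ : Z.Frame)

/-- The image under the change of charts from `i` to `j` of the vector with coframe coordinates
`affineLift a u`. -/
noncomputable def moved (i j : Z.Chart) (a : Fin n)
    (y : Z.Model i × ({b : Fin n // b ≠ a} → ℂ)) : Z.Model j :=
  fderiv ℂ (Z.transition i j) y.1 (Φ.E i y.1 (affineLift a y.2))

include Φ in
theorem analyticAt_cof (i : Z.Chart) (b : Fin n) (x : Z.Model i) :
    AnalyticAt ℂ (Z.cof i b) x := by
  have := Φ.isManifold.finiteDimensional i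
  exact (LinearMap.toContinuousLinearMap (Z.cof i b)).analyticAt x

theorem analyticAt_E_affineLift (i : Z.Chart) (a : Fin n)
    (y : Z.Model i × ({b : Fin n // b ≠ a} → ℂ)) :
    AnalyticAt ℂ (fun y : Z.Model i × ({b : Fin n // b ≠ a} → ℂ) =>
      Φ.E i y.1 (affineLift a y.2)) y :=
  (Φ.analyticAt_E i (y.1, affineLift a y.2)).fun_comp
    (f := fun y : Z.Model i × ({b : Fin n // b ≠ a} → ℂ) => (y.1, affineLift a y.2))
    (analyticAt_fst.prod ((analyticAt_affineLift a y.2).fun_comp analyticAt_snd))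

theorem analyticAt_moved {i j : Z.Chart} (a : Fin n) {z : Z.Pt} (hi : z ∈ Z.dom i)
    (hj : z ∈ Z.dom j) (u : {b : Fin n // b ≠ a} → ℂ) :
    AnalyticAt ℂ (Φ.moved i j a) (Z.coord i z, u) := by
  have := Φ.isManifold.finiteDimensional j
  have := Φ.isManifold.finiteDimensional i
  have := FiniteDimensional.complete ℂ (Z.Model i)
  have := FiniteDimensional.complete ℂ (Z.Model j)
  refine ContDiffAt.analyticAt (ContDiffAt.clm_apply (AnalyticAt.contDiffAt ?_)
    (Φ.analyticAt_E_affineLift i a _).contDiffAt)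
  exact (Φ.isManifold.analyticAt_transition hi hj).fderiv.fun_comp
    (f := fun y : Z.Model i × ({b : Fin n // b ≠ a} → ℂ) => y.1) analyticAt_fst

theorem exists_mk_eq_moved {q : Z.ProjPt} {i a} (hq : q ∈ Z.projAtlas.dom (i, a)) :
    ∃ (v : Z.dist q.base) (hv : v ≠ 0), q.line = Projectivization.mk ℂ v hv ∧
      ∀ (j) (hj : q.base ∈ Z.dom j),
        v.1.1 ⟨j, hj⟩ = Φ.moved i j a (Z.projAtlas.coord (i, a) q) := by
  obtain ⟨v, hv, e, ev⟩ := Φ.exists_mk_eq hq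
  refine ⟨v, hv, e, fun j hj => ?_⟩
  rw [Atlas.IsManifold.tangent_apply hq.1 hj v.1, ev]
  rfl

theorem mem_dom_iff_moved {q : Z.ProjPt} {i a} (hq : q ∈ Z.projAtlas.dom (i, a)) {j}
    (hj : q.base ∈ Z.dom j) (b : Fin n) :
    q ∈ Z.projAtlas.dom (j, b) ↔ Z.cof j b (Φ.moved i j a (Z.projAtlas.coord (i, a) q)) ≠ 0 := by
  obtain ⟨v, hv, e, ev⟩ := Φ.exists_mk_eq_moved hq
  rw [← ev j hj, ← homCoord_ne_iff q e ⟨j, hj⟩]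
  exact ⟨fun h => h.2, fun h => ⟨hj, h⟩⟩

theorem coord_eq_moved {q : Z.ProjPt} {i a j b} (hq : q ∈ Z.projAtlas.dom (i, a))
    (hq' : q ∈ Z.projAtlas.dom (j, b)) :
    Z.projAtlas.coord (j, b) q = (Z.transition i j (Z.projAtlas.coord (i, a) q).1,
      fun c : {c : Fin n // c ≠ b} => Z.cof j c (Φ.moved i j a (Z.projAtlas.coord (i, a) q)) /
        Z.cof j b (Φ.moved i j a (Z.projAtlas.coord (i, a) q))) := by
  obtain ⟨v, hv, e, ev⟩ := Φ.exists_mk_eq_moved hq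
  refine Prod.ext (Φ.isManifold.transition_coord hq.1 hq'.1).symm ?_
  funext c
  have := affineLift_coord_mk hq' e c
  rw [affineLift_of_ne c.2, ev j hq'.1] at this
  exact this

/-- An overlap upstairs is an overlap downstairs together with the non-vanishing of an analytic
function; this is why it is open. -/
theorem image_overlap (i j : Z.Chart) (a b : Fin n) :
    Z.projAtlas.coord (i, a) '' (Z.projAtlas.dom (i, a) ∩ Z.projAtlas.dom (j, b)) =
      {y | y.1 ∈ Z.coord i '' (Z.dom i ∩ Z.dom j) ∧ Z.cof j b (Φ.moved i j a y) ≠ 0} := by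
  ext y
  constructor
  · rintro ⟨q, ⟨h1, h2⟩, rfl⟩
    exact ⟨⟨q.base, ⟨h1.1, h2.1⟩, rfl⟩, (Φ.mem_dom_iff_moved h1 h2.1 b).1 h2⟩
  · rintro ⟨⟨z, ⟨h1, h2⟩, e⟩, h⟩
    obtain ⟨q, hq, hb, hc⟩ := Φ.exists_proj a h1 y.2
    have hy : Z.projAtlas.coord (i, a) q = y := hc.trans (by rw [e])
    subst hb
    refine ⟨q, ⟨hq, (Φ.mem_dom_iff_moved hq h2 b).2 ?_⟩, hy⟩
    rwa [hy]

include Φ in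
theorem isOpen_overlap_proj (i j : Z.Chart) (a b : Fin n) :
    IsOpen (Z.projAtlas.coord (i, a) ''
      (Z.projAtlas.dom (i, a) ∩ Z.projAtlas.dom (j, b))) := by
  rw [Φ.image_overlap, isOpen_iff_mem_nhds]
  rintro ⟨x, u⟩ ⟨⟨z, ⟨h1, h2⟩, rfl⟩, h⟩
  have c1 : ContinuousAt (fun y => Z.cof j b (Φ.moved i j a y)) (Z.coord i z, u) :=
    ((Φ.analyticAt_cof j b _).fun_comp (Φ.analyticAt_moved a h1 h2 u)).continuousAt
  filter_upwards [c1.eventually_ne h,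
    continuousAt_fst.preimage_mem_nhds (Φ.isManifold.overlap_mem_nhds h1 h2)] with y hy hy'
  exact ⟨hy', hy⟩

include Φ in
theorem bijOn_proj (i : Z.Chart) (a : Fin n) :
    Set.BijOn (Z.projAtlas.coord (i, a)) (Z.projAtlas.dom (i, a)) Set.univ := by
  refine ⟨fun _ _ => Set.mem_univ _, fun q hq q' hq' h => Φ.proj_ext hq hq' h, ?_⟩
  rintro ⟨x, u⟩ -
  obtain ⟨z, hz, rfl⟩ := Φ.isManifold.coord_surj i x
  obtain ⟨q, hq, -, hc⟩ := Φ.exists_proj a hz u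
  exact ⟨q, hq, hc⟩

/-- The formula is claimed on the overlap only, `transition` being 0 outside it; as the overlap is
open, this determines the germ. -/
theorem transition_proj_eventuallyEq {q : Z.ProjPt} {i a j b}
    (hq : q ∈ Z.projAtlas.dom (i, a)) (hq' : q ∈ Z.projAtlas.dom (j, b)) :
    Z.projAtlas.transition (i, a) (j, b) =ᶠ[𝓝 (Z.projAtlas.coord (i, a) q)]
      fun y => (Z.transition i j y.1, fun c : {c : Fin n // c ≠ b} =>
        Z.cof j c (Φ.moved i j a y) / Z.cof j b (Φ.moved i j a y)) := by
  filter_upwards [(Φ.isOpen_overlap_proj i j a b).mem_nhds ⟨q, ⟨hq, hq'⟩, rfl⟩] with y hy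
  obtain ⟨r, ⟨h1, h2⟩, rfl⟩ := hy
  rw [← Φ.coord_eq_moved h1 h2]
  have h : ∃ r', r' ∈ Z.projAtlas.dom (i, a) ∧ r' ∈ Z.projAtlas.dom (j, b) ∧
    Z.projAtlas.coord (i, a) r' = Z.projAtlas.coord (i, a) r := ⟨r, h1, h2, rfl⟩
  have e : h.choose = r := Φ.proj_ext h.choose_spec.1 h1 h.choose_spec.2.2
  rw [Atlas.transition, dif_pos h, e]

include Φ in
theorem isManifold_proj : Z.projAtlas.IsManifold where
  finiteDimensional ia := by
    have := Φ.isManifold.finiteDimensional ia.1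
    change FiniteDimensional ℂ (Z.Model ia.1 × _)
    infer_instance
  bijOn ia := Φ.bijOn_proj ia.1 ia.2
  isOpen_overlap ia jb := Φ.isOpen_overlap_proj ia.1 jb.1 ia.2 jb.2
  analyticAt_transition := by
    rintro ⟨i, a⟩ ⟨j, b⟩ q hq hq'
    refine AnalyticAt.congr ?_ (Φ.transition_proj_eventuallyEq hq hq').symm
    have hm := Φ.analyticAt_moved a hq.1 hq'.1 (Z.projAtlas.coord (i, a) q).2
    refine AnalyticAt.prod ((Φ.isManifold.analyticAt_transition hq.1 hq'.1).fun_comp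
      (f := fun y : Z.Model i × ({b : Fin n // b ≠ a} → ℂ) => y.1) analyticAt_fst) ?_
    rw [analyticAt_pi_iff]
    intro c
    exact ((Φ.analyticAt_cof j c.1 _).fun_comp hm).div ((Φ.analyticAt_cof j b _).fun_comp hm)
      ((Φ.mem_dom_iff_moved hq hq'.1 b).1 hq')

include Φ in
-- The base component of a coordinate change ignores the fibre coordinates, so its differential
-- factors through that of the projection.
theorem tangent_proj_fst {q : Z.ProjPt} {i a j b} (hq : q ∈ Z.projAtlas.dom (i, a))
    (hq' : q ∈ Z.projAtlas.dom (j, b)) (v : Z.projAtlas.Tangent q) :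
    (v.1 ⟨(j, b), hq'⟩).1 =
      fderiv ℂ (Z.transition i j) (Z.coord i q.base) (v.1 ⟨(i, a), hq⟩).1 := by
  have h := Φ.isManifold_proj.hasFDerivAt_transition hq hq'
  have e := Atlas.IsManifold.tangent_apply hq hq' v
  have h1 := h.fst
  have h2 := (Φ.isManifold.hasFDerivAt_transition hq.1 hq'.1).comp
    (Z.projAtlas.coord (i, a) q)
    (hasFDerivAt_fst (𝕜 := ℂ) (E := Z.Model i) (F := {b : Fin n // b ≠ a} → ℂ))
  have h3 := h1.unique (h2.congr_of_eventuallyEq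
    ((Φ.transition_proj_eventuallyEq hq hq').fun_comp Prod.fst))
  rw [e]
  exact congrArg (fun T => T (v.1 ⟨(i, a), hq⟩)) h3

include Φ in
/-- To project to `w`, it is enough to do so in one chart. -/
theorem projectsTo_iff {q : Z.ProjPt} {i a} (hq : q ∈ Z.projAtlas.dom (i, a))
    (v : Z.projAtlas.Tangent q) (w : Z.toAtlas.Tangent q.base) :
    Z.ProjectsTo q v w ↔ (v.1 ⟨(i, a), hq⟩).1 = w.1 ⟨i, hq.1⟩ := by
  refine ⟨fun h => h _, fun h => ?_⟩
  rintro ⟨⟨j, b⟩, hq'⟩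
  rw [Φ.tangent_proj_fst hq hq' v, h]
  exact (Atlas.IsManifold.tangent_apply hq.1 hq'.1 w).symm

theorem lineIn_mk {z : Z.Pt} {v : Z.dist z} {hv : v ≠ 0} :
    Z.lineIn (Projectivization.mk ℂ v hv) = Submodule.span ℂ {v.1} := by
  rw [lineIn, Projectivization.submodule_mk, Submodule.map_span, Set.image_singleton]
  rfl

theorem mem_lineIn_mk {z : Z.Pt} {v : Z.dist z} {hv : v ≠ 0} {w : Z.toAtlas.Tangent z} :
    w ∈ Z.lineIn (Projectivization.mk ℂ v hv) ↔ ∃ c : ℂ, w = c • v.1 := by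
  rw [lineIn_mk, Submodule.mem_span_singleton]
  exact ⟨fun ⟨c, h⟩ => ⟨c, h.symm⟩, fun ⟨c, h⟩ => ⟨c, h.symm⟩⟩

theorem mem_prolong_dist {q : Z.ProjPt} {i a} (hq : q ∈ Z.projAtlas.dom (i, a))
    (v : Z.projAtlas.Tangent q) :
    v ∈ Z.prolong.dist q ↔ ∃ c : ℂ, (v.1 ⟨(i, a), hq⟩).1 =
      c • Φ.E i (Z.coord i q.base) (affineLift a (Z.projAtlas.coord (i, a) q).2) := by
  obtain ⟨w, hw, e, ew⟩ := Φ.exists_mk_eq hq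
  change (∃ x ∈ Z.lineIn q.line, Z.ProjectsTo q v x) ↔ _
  rw [e, ← ew]
  constructor
  · rintro ⟨x, hx, h⟩
    obtain ⟨c, rfl⟩ := mem_lineIn_mk.1 hx
    exact ⟨c, (Φ.projectsTo_iff hq v _).1 h⟩
  · rintro ⟨c, h⟩
    exact ⟨c • w.1, mem_lineIn_mk.2 ⟨c, rfl⟩, (Φ.projectsTo_iff hq v _).2 h⟩

end Frame

end DistManifold

/-! ### The frame of a prolongation and of the Monster -/

namespace DistManifold

/-- The parametrization of the distribution of `ℙ D` in the chart `(i, a)`. -/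
noncomputable def prolongE {Z : DistManifold n} (Φ : Z.Frame) (i : Z.Chart) (a : Fin n)
    (y : Z.Model i × ({b : Fin n // b ≠ a} → ℂ)) :
    (Fin n → ℂ) →ₗ[ℂ] Z.Model i × ({b : Fin n // b ≠ a} → ℂ) where
  toFun w := (w a • Φ.E i y.1 (affineLift a y.2), fun b => w b.1)
  map_add' _ _ := Prod.ext (add_smul _ _ _) rfl
  map_smul' _ _ := Prod.ext (mul_smul _ _ _) rfl

theorem prolong_cof_self (Z : DistManifold n) (i : Z.Chart) (a : Fin n)
    (y : Z.Model i × ({b : Fin n // b ≠ a} → ℂ)) :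
    Z.prolong.cof (i, a) a y = Z.cof i a y.1 := by
  simp

theorem prolong_cof_of_ne (Z : DistManifold n) (i : Z.Chart) {a b : Fin n} (h : b ≠ a)
    (y : Z.Model i × ({b : Fin n // b ≠ a} → ℂ)) :
    Z.prolong.cof (i, a) b y = y.2 ⟨b, h⟩ := by
  simp [h]

namespace Frame

variable {Z : DistManifold n} (Φ : Z.Frame)

/-- The frame of the prolongation. -/
noncomputable def prolong : Z.prolong.Frame where
  isManifold := Φ.isManifold_proj
  E ia y := prolongE Φ ia.1 ia.2 y
  analyticAt_E := by
    rintro ⟨i, a⟩ ⟨y, w⟩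
    refine AnalyticAt.prod (AnalyticAt.smul ?_ ?_) ?_
    · exact ((ContinuousLinearMap.proj (R := ℂ) (φ := fun _ : Fin n => ℂ) a).comp
        (ContinuousLinearMap.snd ℂ (Z.Model i × ({b : Fin n // b ≠ a} → ℂ))
          (Fin n → ℂ))).analyticAt _
    · exact AnalyticAt.fun_comp (x := (y, w))
        (f := fun p : (Z.Model i × ({b : Fin n // b ≠ a} → ℂ)) × (Fin n → ℂ) => p.1)
        (Φ.analyticAt_E_affineLift i a y) analyticAt_fst
    · rw [analyticAt_pi_iff]
      intro b
      exact ((ContinuousLinearMap.proj (R := ℂ) (φ := fun _ : Fin n => ℂ) b.1).comp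
        (ContinuousLinearMap.snd ℂ (Z.Model i × ({b : Fin n // b ≠ a} → ℂ))
          (Fin n → ℂ))).analyticAt _
  cof_E := by
    rintro ⟨i, a⟩ y w b
    by_cases h : b = a
    · subst h
      rw [prolong_cof_self]
      change Z.cof i b (w b • Φ.E i y.1 (affineLift b y.2)) = w b
      rw [map_smul, Φ.cof_E, affineLift_self, smul_eq_mul, mul_one]
    · exact prolong_cof_of_ne Z i h _
  mem_dist := by
    rintro ⟨i, a⟩ q hq v
    refine (Φ.mem_prolong_dist hq v).trans ⟨?_, ?_⟩
    · rintro ⟨c, hc⟩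
      refine ⟨fun b => if h : b = a then c else (v.1 ⟨(i, a), hq⟩).2 ⟨b, h⟩, Prod.ext ?_ ?_⟩
      · rw [hc]
        simp [prolongE]
      · funext b
        simp [prolongE, b.2]
    · rintro ⟨w, hw⟩
      exact ⟨w a, by rw [hw]; rfl⟩

end Frame

end DistManifold

open DistManifold

theorem affineSpace_isManifold (n : ℕ) : (affineSpace n).toAtlas.IsManifold := by
  have ht : ∀ i j, (affineSpace n).transition i j = id := by
    intro i j
    funext c
    have h : ∃ q, q ∈ (affineSpace n).dom i ∧ q ∈ (affineSpace n).dom j ∧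
      (affineSpace n).coord i q = c := ⟨c, trivial, trivial, rfl⟩
    rw [Atlas.transition, dif_pos h]
    exact h.choose_spec.2.2
  refine ⟨fun _ => ?_, fun _ => Set.bijOn_univ.2 Function.bijective_id, fun i j => ?_, ?_⟩
  · change FiniteDimensional ℂ (Fin n → ℂ)
    infer_instance
  · change IsOpen ((fun x : Fin n → ℂ => x) '' (Set.univ ∩ Set.univ))
    simp
  · intro i j p _ _
    rw [ht]
    exact analyticAt_id

/-- The frame of affine space. -/
noncomputable def affineFrame (n : ℕ) : (affineSpace n).Frame where
  isManifold := affineSpace_isManifold n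
  E _ _ := LinearMap.id
  analyticAt_E _ _ := analyticAt_snd
  cof_E _ _ _ _ := rfl
  mem_dist _ _ := ⟨fun _ => ⟨_, rfl⟩, fun _ => Submodule.mem_top⟩

/-- The frame of the Monster. -/
noncomputable def monsterFrame (n : ℕ) : ∀ k, (monster n k).Frame
  | 0 => affineFrame n
  | k + 1 => (monsterFrame n k).prolong

/-! ### Points, curves and straight lines given by coordinates -/

namespace Atlas.IsManifold

variable {M : Atlas} (hM : M.IsManifold)
include hM

/-- The point with coordinates `c` in the chart `i`. -/
noncomputable def point (i : M.Chart) (c : M.Model i) : M.Pt := (hM.coord_surj i c).choose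

theorem point_mem (i : M.Chart) (c : M.Model i) : hM.point i c ∈ M.dom i :=
  (hM.coord_surj i c).choose_spec.1

theorem coord_point (i : M.Chart) (c : M.Model i) : M.coord i (hM.point i c) = c :=
  (hM.coord_surj i c).choose_spec.2

theorem point_coord {i : M.Chart} {p : M.Pt} (hp : p ∈ M.dom i) : hM.point i (M.coord i p) = p :=
  (hM.bijOn i).injOn (hM.point_mem i _) hp (hM.coord_point i _)

theorem hasVelocityAt_point {i : M.Chart} {c : ℂ → M.Model i} {t₀ : ℂ} {p : M.Pt}
    (hp : p ∈ M.dom i) (h0 : c t₀ = M.coord i p) {v : M.Tangent p}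
    (hd : HasDerivAt c (v.1 ⟨i, hp⟩) t₀) :
    HasVelocityAt (fun t => hM.point i (c t)) t₀ p v := by
  refine hM.hasVelocityAt_of_chart hp ?_ (Eventually.of_forall fun t => hM.point_mem i _) ?_
  · simp only [h0]
    exact hM.point_coord hp
  · simpa only [hM.coord_point] using hd

theorem analyticCurveAt_point {i : M.Chart} {c : ℂ → M.Model i} {t₀ : ℂ}
    (ha : AnalyticAt ℂ c t₀) : AnalyticCurveAt (fun t => hM.point i (c t)) t₀ := by
  refine hM.analyticCurveAt_of_chart (hM.point_mem i _)
    (Eventually.of_forall fun t => hM.point_mem i _) ?_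
  simpa only [hM.coord_point] using ha

/-- Velocities of straight lines in a chart. -/
theorem mem_tangentOfSubset {i : M.Chart} {p : M.Pt} (hp : p ∈ M.dom i) {v : M.Tangent p}
    {S : Set M.Pt} (h : ∀ t : ℂ, hM.point i (M.coord i p + t • v.1 ⟨i, hp⟩) ∈ S) :
    v ∈ tangentOfSubset S p := by
  refine ⟨_, hM.analyticCurveAt_point (c := fun t : ℂ => M.coord i p + t • v.1 ⟨i, hp⟩) ?_,
    Eventually.of_forall h, hM.hasVelocityAt_point hp (by simp) ?_⟩
  · exact analyticAt_const.add (analyticAt_id.smul analyticAt_const)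
  · simpa using ((hasDerivAt_id (0 : ℂ)).smul_const (v.1 ⟨i, hp⟩)).const_add (M.coord i p)

end Atlas.IsManifold

/-! ### Fibres, their first prolongations and the tangent spaces of both -/

namespace DistManifold.Frame

variable {Z : DistManifold n} (Φ : Z.Frame)
include Φ

theorem mem_verticalSpace_iff {q : Z.ProjPt} {i a} (hq : q ∈ Z.projAtlas.dom (i, a))
    (v : Z.projAtlas.Tangent q) :
    v ∈ Z.verticalSpace q ↔ (v.1 ⟨(i, a), hq⟩).1 = 0 :=
  Φ.projectsTo_iff hq v 0

theorem mem_verticalSpace_iff_cof {q : Z.ProjPt} {i a} (hq : q ∈ Z.projAtlas.dom (i, a))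
    {v : Z.projAtlas.Tangent q} (hv : v ∈ Z.prolong.dist q) :
    v ∈ Z.verticalSpace q ↔ Z.prolong.cof (i, a) a (v.1 ⟨(i, a), hq⟩) = 0 := by
  rw [Φ.mem_verticalSpace_iff hq, prolong_cof_self]
  obtain ⟨c, hc⟩ := (Φ.mem_prolong_dist hq v).1 hv
  refine ⟨fun h => by rw [h, map_zero], fun h => ?_⟩
  rw [hc, map_smul, Φ.cof_E, affineLift_self, smul_eq_mul, mul_one] at h
  rw [hc, h, zero_smul]

theorem lineIn_subset_verticalSpace_iff {p : Z.prolong.ProjPt} {i a}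
    (hq : p.base ∈ Z.projAtlas.dom (i, a)) :
    (Z.prolong.lineIn p.line : Set (Z.projAtlas.Tangent p.base)) ⊆ Z.verticalSpace p.base ↔
      Z.prolong.homCoord p ⟨(i, a), hq⟩ a = 0 := by
  obtain ⟨v, hv, e⟩ := exists_line_eq_mk p
  rw [e]
  refine Iff.trans (Iff.trans ?_ (Φ.mem_verticalSpace_iff_cof hq v.2))
    (homCoord_eq_zero_iff p e ⟨(i, a), hq⟩ a).symm
  constructor
  · intro h
    exact h (mem_lineIn_mk.2 ⟨1, (one_smul _ _).symm⟩)
  · rintro h w hw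
    obtain ⟨c, rfl⟩ := mem_lineIn_mk.1 hw
    rw [Φ.mem_verticalSpace_iff hq] at h ⊢
    change c • (v.1.1 ⟨(i, a), hq⟩).1 = 0
    rw [h, smul_zero]

/-- The base coordinates are constant along a curve in the fibre; conversely a straight line in the
chart with vertical velocity never leaves the fibre. -/
theorem tangentOfSubset_fiber {q : Z.ProjPt} {i a} (hq : q ∈ Z.projAtlas.dom (i, a)) :
    Atlas.tangentOfSubset (M := Z.projAtlas) {q' | q'.base = q.base} q = Z.verticalSpace q := by
  ext v
  rw [Φ.mem_verticalSpace_iff hq]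
  constructor
  · rintro ⟨σ, -, hS, -, hd⟩
    have h1 : HasDerivAt (fun t => (Z.projAtlas.coord (i, a) (σ t)).1)
        (v.1 ⟨(i, a), hq⟩).1 0 :=
      (ContinuousLinearMap.fst ℂ (Z.Model i) ({b : Fin n // b ≠ a} → ℂ)).hasFDerivAt.comp_hasDerivAt
        (0 : ℂ) (hd ⟨(i, a), hq⟩)
    have h2 : HasDerivAt (fun t => (Z.projAtlas.coord (i, a) (σ t)).1) 0 0 := by
      refine (hasDerivAt_const (0 : ℂ) (Z.coord i q.base)).congr_of_eventuallyEq ?_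
      filter_upwards [hS] with t ht
      exact congrArg (Z.coord i) ht
    exact h1.unique h2
  · intro h
    refine Φ.isManifold_proj.mem_tangentOfSubset hq fun t => ?_
    have hm := Φ.isManifold_proj.point_mem (i, a)
      (Z.projAtlas.coord (i, a) q + t • v.1 ⟨(i, a), hq⟩)
    have hc := Φ.isManifold_proj.coord_point (i, a)
      (Z.projAtlas.coord (i, a) q + t • v.1 ⟨(i, a), hq⟩)
    refine (Φ.isManifold.bijOn i).injOn hm.1 hq.1 ((congrArg Prod.fst hc).trans ?_)
    rw [Prod.fst_add, Prod.smul_fst, h, smul_zero, add_zero]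

omit Φ in
theorem coord_snd_eq_zero_iff {p : Z.ProjPt} {i a} (hp : p ∈ Z.projAtlas.dom (i, a))
    (c : {c : Fin n // c ≠ a}) :
    (Z.projAtlas.coord (i, a) p).2 c = 0 ↔ Z.homCoord p ⟨i, hp.1⟩ c = 0 := by
  rw [coord_snd hp.1, div_eq_zero_iff, or_iff_left hp.2]

/-- Tangency to the fibre means df_a = 0 on the line, and in the chart ((i, a), b) this is the
vanishing of the affine coordinate u_a = df_a/df_b. So the prolonged fibre is a coordinate subspace
of the chart. -/
theorem mem_prolongSubset_fiber_iff {p : Z.prolong.ProjPt} {i a b} (hab : a ≠ b)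
    (hp : p ∈ Z.prolong.projAtlas.dom ((i, a), b)) (z : Z.Pt) :
    p ∈ Z.prolong.prolongSubset {q | q.base = z} ↔
      p.base.base = z ∧ (Z.prolong.projAtlas.coord ((i, a), b) p).2 ⟨a, hab⟩ = 0 := by
  rw [coord_snd_eq_zero_iff hp, ← Φ.lineIn_subset_verticalSpace_iff hp.1,
    ← Φ.tangentOfSubset_fiber hp.1]
  constructor
  · rintro ⟨rfl, h⟩
    exact ⟨rfl, h⟩
  · rintro ⟨rfl, h⟩
    exact ⟨rfl, h⟩

theorem tangentOfSubset_prolong_fiber {p : Z.prolong.ProjPt} {i a b} (hab : a ≠ b)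
    (hp : p ∈ Z.prolong.projAtlas.dom ((i, a), b)) {v : Z.prolong.projAtlas.Tangent p}
    (hv : v ∈ Atlas.tangentOfSubset (M := Z.prolong.projAtlas)
      (Z.prolong.prolongSubset {q | q.base = p.base.base}) p) :
    (v.1 ⟨((i, a), b), hp⟩).2 ⟨a, hab⟩ = 0 := by
  obtain ⟨σ, hσ, hS, h0, hd⟩ := hv
  have h1 : HasDerivAt (fun t => (Z.prolong.projAtlas.coord ((i, a), b) (σ t)).2 ⟨a, hab⟩)
      ((v.1 ⟨((i, a), b), hp⟩).2 ⟨a, hab⟩) 0 :=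
    hasDerivAt_pi.1 ((ContinuousLinearMap.snd ℂ (Z.prolong.Model (i, a))
      ({c : Fin n // c ≠ b} → ℂ)).hasFDerivAt.comp_hasDerivAt
        (0 : ℂ) (hd ⟨((i, a), b), hp⟩)) ⟨a, hab⟩
  refine h1.unique ((hasDerivAt_const (0 : ℂ) (0 : ℂ)).congr_of_eventuallyEq ?_)
  filter_upwards [hS, (hσ ⟨((i, a), b), by rw [h0]; exact hp⟩).1] with t ht ht'
  exact ((Φ.mem_prolongSubset_fiber_iff hab ht' _).1 ht).2

/-- The straight line with velocity v stays in the prolonged fibre: along it u_a remains 0, and the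
base point does not move. -/
theorem mem_tangentOfSubset_prolong_fiber {p : Z.prolong.ProjPt} {i a b} (hab : a ≠ b)
    (hp : p ∈ Z.prolong.projAtlas.dom ((i, a), b))
    (hz : (Z.prolong.projAtlas.coord ((i, a), b) p).2 ⟨a, hab⟩ = 0)
    {v : Z.prolong.projAtlas.Tangent p} (hv : v ∈ Z.prolong.prolong.dist p)
    (h : (v.1 ⟨((i, a), b), hp⟩).2 ⟨a, hab⟩ = 0) :
    v ∈ Atlas.tangentOfSubset (M := Z.prolong.projAtlas)
      (Z.prolong.prolongSubset {q | q.base = p.base.base}) p := by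
  have hM := Φ.prolong.isManifold_proj
  refine hM.mem_tangentOfSubset hp fun t => ?_
  have hm := hM.point_mem ((i, a), b)
    (Z.prolong.projAtlas.coord ((i, a), b) p + t • v.1 ⟨((i, a), b), hp⟩)
  have hc := hM.coord_point ((i, a), b)
    (Z.prolong.projAtlas.coord ((i, a), b) p + t • v.1 ⟨((i, a), b), hp⟩)
  rw [Φ.mem_prolongSubset_fiber_iff hab hm]
  constructor
  · have hv1 : (v.1 ⟨((i, a), b), hp⟩).1.1 = 0 := by
      obtain ⟨c, e⟩ := (Φ.prolong.mem_prolong_dist hp v).1 hv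
      have e1 := congrArg Prod.fst e
      refine e1.trans ?_
      change c • (affineLift b (Z.prolong.projAtlas.coord ((i, a), b) p).2 a • _) = _
      rw [affineLift_of_ne hab, hz, zero_smul, smul_zero]
    refine (Φ.isManifold.bijOn i).injOn hm.1.1 hp.1.1
      ((congrArg (fun y => y.1.1) hc).trans ?_)
    change _ + t • (v.1 ⟨((i, a), b), hp⟩).1.1 = _
    rw [hv1, smul_zero, add_zero]
  · rw [hc]
    change (Z.prolong.projAtlas.coord ((i, a), b) p).2 ⟨a, hab⟩ +
      t • (v.1 ⟨((i, a), b), hp⟩).2 ⟨a, hab⟩ = 0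
    rw [hz, h, smul_zero, add_zero]

end DistManifold.Frame

/-! ### Prolongation of curves in coordinates -/

namespace DistManifold

theorem IsCurveProlongation.base_eq {Z : DistManifold n} {τ : ℂ → Z.Pt} {σ : ℂ → Z.ProjPt}
    (h : Z.IsCurveProlongation τ σ) : ∀ᶠ t in 𝓝 (0 : ℂ), (σ t).base = τ t := by
  obtain ⟨-, -, h0, h1⟩ := h
  rw [eventually_nhdsWithin_iff] at h1
  filter_upwards [h1] with t ht
  by_cases h : t = 0
  · rw [h, h0]
  · obtain ⟨v, -, hv, -⟩ := ht h
    exact hv.1.symm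

theorem IsCurveProlongation.mem_dom {Z : DistManifold n} {τ : ℂ → Z.Pt} {σ : ℂ → Z.ProjPt}
    (h : Z.IsCurveProlongation τ σ) {i a} (h0 : σ 0 ∈ Z.projAtlas.dom (i, a)) :
    τ 0 ∈ Z.dom i := h.2.2.1 ▸ h0.1

namespace Frame

variable {Z : DistManifold n} (Φ : Z.Frame)
include Φ

theorem analyticAt_cof_coord {τ : ℂ → Z.Pt} (hτ : Atlas.AnalyticCurveAt (M := Z.toAtlas) τ 0)
    {i} (hi : τ 0 ∈ Z.dom i) (b : Fin n) :
    AnalyticAt ℂ (fun t => Z.cof i b (Z.coord i (τ t))) 0 :=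
  (Φ.analyticAt_cof i b _).fun_comp (hτ ⟨i, hi⟩).2

theorem hasDerivAt_cof_coord {τ : ℂ → Z.Pt} {t : ℂ} {z : Z.Pt} {v : Z.toAtlas.Tangent z}
    (h : Atlas.HasVelocityAt τ t z v) {i} (hi : z ∈ Z.dom i) (b : Fin n) :
    HasDerivAt (fun t => Z.cof i b (Z.coord i (τ t))) (Z.cof i b (v.1 ⟨i, hi⟩)) t := by
  have := Φ.isManifold.finiteDimensional i
  exact (LinearMap.toContinuousLinearMap (Z.cof i b)).hasFDerivAt.comp_hasDerivAt t (h.2 ⟨i, hi⟩)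

omit Φ in
theorem analyticAt_affineLift_coord {σ : ℂ → Z.ProjPt}
    (hσ : Atlas.AnalyticCurveAt (M := Z.projAtlas) σ 0) {i a}
    (h0 : σ 0 ∈ Z.projAtlas.dom (i, a)) (b : Fin n) :
    AnalyticAt ℂ (fun t => affineLift a (Z.projAtlas.coord (i, a) (σ t)).2 b) 0 := by
  have h1 : AnalyticAt ℂ (fun t => (Z.projAtlas.coord (i, a) (σ t)).2) 0 :=
    ((ContinuousLinearMap.snd ℂ (Z.Model i) ({b : Fin n // b ≠ a} → ℂ)).analyticAt _).fun_comp
      (hσ ⟨(i, a), h0⟩).2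
  exact analyticAt_pi_iff.1 ((analyticAt_affineLift a _).fun_comp h1) b

/-- For t ≠ 0 the affine coordinates of the prolonged curve are quotients of derivatives. With the
denominator cleared both sides are analytic, so the identity persists at t = 0, where the velocity
may vanish. -/
theorem deriv_cof_eq {τ : ℂ → Z.Pt} {σ : ℂ → Z.ProjPt} (h : Z.IsCurveProlongation τ σ) {i a}
    (h0 : σ 0 ∈ Z.projAtlas.dom (i, a)) (b : Fin n) :
    deriv (fun s => Z.cof i b (Z.coord i (τ s))) =ᶠ[𝓝 0] fun t =>
      affineLift a (Z.projAtlas.coord (i, a) (σ t)).2 b *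
        deriv (fun s => Z.cof i a (Z.coord i (τ s))) t := by
  have hτ0 := h.mem_dom h0
  obtain ⟨hτ, hσ, -, h1⟩ := h
  refine (ContinuousAt.eventuallyEq_nhds_iff_eventuallyEq_nhdsNE
    (Φ.analyticAt_cof_coord hτ hτ0 b).deriv.continuousAt
    ((analyticAt_affineLift_coord hσ h0 b).mul
      (Φ.analyticAt_cof_coord hτ hτ0 a).deriv).continuousAt).1 ?_
  filter_upwards [h1, nhdsWithin_le_nhds (hσ ⟨(i, a), h0⟩).1] with t ht hd
  obtain ⟨v, hv, hvel, e⟩ := ht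
  change σ t ∈ Z.projAtlas.dom (i, a) at hd
  refine (Φ.hasDerivAt_cof_coord hvel hd.1 b).deriv.trans ?_
  change _ = affineLift a (Z.projAtlas.coord (i, a) (σ t)).2 b *
    deriv (fun s => Z.cof i a (Z.coord i (τ s))) t
  rw [(Φ.hasDerivAt_cof_coord hvel hd.1 a).deriv,
    affineLift_coord_mk hd e, div_mul_cancel₀]
  exact (homCoord_ne_iff _ e _ _).1 hd.2

/-- A curve in `ℙ D` over `τ` whose lines are spanned by the velocities of `τ`, as read in one
chart, is the prolongation of `τ`. -/
theorem isCurveProlongation_of_chart {τ : ℂ → Z.Pt} {σ : ℂ → Z.ProjPt} {i a}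
    (hσ : ∀ t, σ t ∈ Z.projAtlas.dom (i, a)) (hb : ∀ t, (σ t).base = τ t)
    (ha : AnalyticAt ℂ (fun t => Z.projAtlas.coord (i, a) (σ t)) 0)
    (c : ℂ → ℂ) (hc : ∀ t, t ≠ 0 → c t ≠ 0)
    (hd : ∀ t, HasDerivAt (fun t => Z.coord i (τ t))
      (c t • Φ.E i (Z.coord i (τ t)) (affineLift a (Z.projAtlas.coord (i, a) (σ t)).2)) t) :
    Z.IsCurveProlongation τ σ := by
  have hτ : ∀ t, τ t ∈ Z.dom i := fun t => hb t ▸ (hσ t).1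
  refine ⟨Φ.isManifold.analyticCurveAt_of_chart (hτ 0) (Eventually.of_forall hτ) ?_,
    Φ.isManifold_proj.analyticCurveAt_of_chart (hσ 0) (Eventually.of_forall hσ) ha, hb 0, ?_⟩
  · refine (((ContinuousLinearMap.fst ℂ (Z.Model i) ({b : Fin n // b ≠ a} → ℂ)).analyticAt
      _).fun_comp ha).congr (Eventually.of_forall fun t => ?_)
    change Z.coord i (σ t).base = _
    rw [hb]
  · filter_upwards [self_mem_nhdsWithin] with t ht
    obtain ⟨v, hv, e, ev⟩ := Φ.exists_mk_eq (hσ t)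
    refine ⟨c t • v, smul_ne_zero (hc t ht) hv,
      Φ.isManifold.hasVelocityAt_of_chart (hσ t).1 (hb t).symm (Eventually.of_forall hτ) ?_, ?_⟩
    · change HasDerivAt _ (c t • v.1.1 ⟨i, (hσ t).1⟩) t
      have h := hd t
      rw [show Z.coord i (τ t) = Z.coord i (σ t).base by rw [hb]] at h
      rwa [ev]
    · rw [e, Projectivization.mk_eq_mk_iff']
      exact ⟨(c t)⁻¹, by rw [smul_smul, inv_mul_cancel₀ (hc t ht), one_smul]⟩

end Frame

end DistManifold

/-! ### Parity, divisibility and square roots of analytic functions -/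

section Analysis

variable {V : Type*} [NormedAddCommGroup V] [NormedSpace ℂ V]

/-- An even analytic function is an analytic function of the square. -/
theorem AnalyticAt.exists_comp_sq_of_even {f : ℂ → V} (hf : AnalyticAt ℂ f 0)
    (he : ∀ᶠ s in 𝓝 (0 : ℂ), f (-s) = f s) :
    ∃ g : ℂ → V, AnalyticAt ℂ g 0 ∧ ∀ᶠ s in 𝓝 (0 : ℂ), f s = g (s ^ 2) := by
  obtain ⟨p, hp⟩ := hf
  rw [hasFPowerSeriesAt_iff] at hp
  simp only [zero_add] at hp
  -- An arbitrary square root, possibly discontinuous, suffices: only r(t)² = t and r(t) → 0 are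
  -- used, and analyticity of f ∘ r comes from the power series below.
  choose r hr using fun t : ℂ => IsAlgClosed.exists_pow_nat_eq t (n := 2) two_pos
  have hr0 : Tendsto r (𝓝 0) (𝓝 0) := by
    rw [Metric.tendsto_nhds_nhds]
    intro ε hε
    refine ⟨ε ^ 2, by positivity, fun {t} ht => ?_⟩
    rw [dist_zero_right] at ht ⊢
    rw [← hr t, norm_pow] at ht
    exact lt_of_pow_lt_pow_left₀ 2 hε.le ht
  have hsum : ∀ᶠ s in 𝓝 (0 : ℂ), HasSum (fun n => (s ^ 2) ^ n • p.coeff (2 * n)) (f s) := by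
    have hneg : Tendsto (fun s : ℂ => -s) (𝓝 0) (𝓝 0) := by
      simpa using (continuous_neg (G := ℂ)).tendsto 0
    filter_upwards [hp, hneg.eventually hp, he] with s h1 h2 h3
    rw [h3] at h2
    have h4 := (h1.add h2).const_smul (2⁻¹ : ℂ)
    rw [← two_smul ℂ (f s), smul_smul, inv_mul_cancel₀ two_ne_zero, one_smul] at h4
    -- The averaged series at s and -s has no odd terms, so it may be summed over even indices.
    rw [← Function.Injective.hasSum_iff (g := fun n : ℕ => 2 * n)
      (mul_right_injective₀ two_ne_zero)] at h4
    · refine h4.congr_fun fun n => ?_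
      simp only [Function.comp_apply]
      rw [← add_smul, smul_smul, Even.neg_pow ⟨n, two_mul n⟩, pow_mul]
      congr 1
      ring
    · intro n hn
      have ho : Odd n := by
        rw [← Nat.not_even_iff_odd]
        rintro ⟨m, rfl⟩
        exact hn ⟨m, two_mul m⟩
      simp [ho.neg_pow]
  let q : FormalMultilinearSeries ℂ ℂ V := fun n =>
    ContinuousMultilinearMap.mkPiRing ℂ (Fin n) (p.coeff (2 * n))
  have hq : ∀ n, q.coeff n = p.coeff (2 * n) := fun n => by
    change ContinuousMultilinearMap.mkPiRing ℂ (Fin n) (p.coeff (2 * n)) 1 = _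
    simp
  refine ⟨f ∘ r, ⟨q, ?_⟩, ?_⟩
  · rw [hasFPowerSeriesAt_iff]
    filter_upwards [hr0.eventually hsum] with t ht
    rw [hr] at ht
    simpa only [zero_add, hq, Function.comp_apply] using ht
  · filter_upwards [he] with s hs
    have := hr (s ^ 2)
    rcases sq_eq_sq_iff_eq_or_eq_neg.1 this with h | h
    · rw [Function.comp_apply, h]
    · rw [Function.comp_apply, h, hs]

/-- Divisibility by powers of the parameter is inherited from the derivative. -/
theorem AnalyticAt.exists_eq_pow_smul_of_deriv [CompleteSpace V] {F M : ℂ → V} {r : ℕ}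
    (hF : AnalyticAt ℂ F 0) (h0 : F 0 = 0) (hM : AnalyticAt ℂ M 0)
    (hd : deriv F =ᶠ[𝓝 0] fun s => s ^ r • M s) :
    ∃ N : ℂ → V, AnalyticAt ℂ N 0 ∧ (F =ᶠ[𝓝 0] fun s => s ^ (r + 1) • N s) ∧
      ((r : ℂ) + 1) • N 0 = M 0 := by
  have h1 : (r : ℕ∞) ≤ analyticOrderAt (deriv F) 0 :=
    (natCast_le_analyticOrderAt hF.deriv).2 ⟨M, hM, by simpa only [sub_zero] using! hd⟩
  have h2 : ((r + 1 : ℕ) : ℕ∞) ≤ analyticOrderAt F 0 := by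
    have := hF.analyticOrderAt_deriv_add_one
    simp only [h0, sub_zero] at this
    rw [← this]
    push_cast
    gcongr
  obtain ⟨N, hN, e⟩ := (natCast_le_analyticOrderAt hF).1 h2
  simp only [sub_zero] at e
  refine ⟨N, hN, e, ?_⟩
  -- Differentiate F = s^(r+1) N and cancel s^r away from 0; continuity then gives the value at 0.
  have e1 : M =ᶠ[𝓝[≠] 0] fun s => ((r : ℂ) + 1) • N s + s • deriv N s := by
    have e2 := EventuallyEq.deriv (show F =ᶠ[𝓝 0] fun s => s ^ (r + 1) • N s from e)
    have e3 := hN.eventually_analyticAt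
    filter_upwards [nhdsWithin_le_nhds e2, nhdsWithin_le_nhds e3, nhdsWithin_le_nhds hd,
      self_mem_nhdsWithin] with s h2 h3 h4 hs
    have hp : s ^ r ≠ 0 := pow_ne_zero _ hs
    have h5 := ((hasDerivAt_pow (r + 1) s).smul h3.differentiableAt.hasDerivAt).deriv
    change deriv (fun s => s ^ (r + 1) • N s) s = _ at h5
    rw [h4, h5] at h2
    apply smul_right_injective V hp
    simp only [h2, smul_add, smul_smul]
    rw [add_comm]
    push_cast
    congr 2
    ring
  have e4 := (ContinuousAt.eventuallyEq_nhds_iff_eventuallyEq_nhdsNE hM.continuousAt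
    ((hN.const_smul (c := (r : ℂ) + 1)).add (analyticAt_id.smul hN.deriv)).continuousAt).1 e1
  simpa using e4.eq_of_nhds.symm

/-- A function with a nondegenerate critical point is a square in a suitable coordinate. -/
theorem AnalyticAt.exists_reparam_sq {ξ : ℂ → ℂ} (hξ : AnalyticAt ℂ ξ 0) (h1 : deriv ξ 0 = 0)
    (h2 : deriv (deriv ξ) 0 ≠ 0) :
    ∃ θ ρ : ℂ → ℂ, AnalyticAt ℂ θ 0 ∧ AnalyticAt ℂ ρ 0 ∧ θ 0 = 0 ∧ ρ 0 = 0 ∧ deriv θ 0 ≠ 0 ∧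
      (∀ᶠ s in 𝓝 0, θ (ρ s) = s) ∧ ∀ᶠ s in 𝓝 0, ξ (θ s) = ξ 0 + s ^ 2 := by
  obtain ⟨M, hM, eM, M0⟩ := hξ.deriv.exists_eq_pow_smul_of_deriv (r := 0) h1 hξ.deriv.deriv
    (by simp)
  obtain ⟨N, hN, eN, N0⟩ := (hξ.sub (analyticAt_const (v := ξ 0))).exists_eq_pow_smul_of_deriv
    (r := 1) (sub_self _) hM (by
      refine EventuallyEq.trans (Eventually.of_forall fun s => ?_) eM
      exact deriv_sub_const (ξ 0))
  have hN0 : N 0 ≠ 0 := by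
    intro h
    apply h2
    rw [← M0, ← N0, h]
    simp
  obtain ⟨c, hc⟩ := IsAlgClosed.exists_pow_nat_eq (N 0) (n := 2) two_pos
  have hc0 : c ≠ 0 := by
    rintro rfl
    exact hN0 (by rw [← hc]; simp)
  have hdiv : AnalyticAt ℂ (fun s => N s / N 0) 0 := hN.div analyticAt_const hN0
  -- An analytic square root of N: division by N 0 brings the argument of the logarithm to 1 at s =
  -- 0, and c² = N 0 restores the factor.
  have hR : AnalyticAt ℂ (fun s => c * Complex.exp (Complex.log (N s / N 0) / 2)) 0 := by
    refine analyticAt_const.mul (AnalyticAt.cexp ?_)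
    refine AnalyticAt.div ?_ analyticAt_const two_ne_zero
    exact hdiv.clog (by rw [div_self hN0]; exact Complex.one_mem_slitPlane)
  set R : ℂ → ℂ := fun s => c * Complex.exp (Complex.log (N s / N 0) / 2) with hRdef
  have R0 : R 0 = c := by simp [hRdef, div_self hN0]
  have hRsq : ∀ᶠ s in 𝓝 0, R s ^ 2 = N s := by
    filter_upwards [hN.continuousAt.eventually_ne hN0] with s hs
    simp only [hRdef, mul_pow, hc]
    rw [← Complex.exp_nat_mul, show ((2 : ℕ) : ℂ) * (Complex.log (N s / N 0) / 2) =
      Complex.log (N s / N 0) by push_cast; ring, Complex.exp_log (div_ne_zero hs hN0),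
      mul_div_cancel₀ _ hN0]
  have hρ : AnalyticAt ℂ (fun s => s * R s) 0 := analyticAt_id.mul hR
  have hρ' : deriv (fun s => s * R s) 0 = c := by
    have := ((hasDerivAt_id (0 : ℂ)).mul hR.differentiableAt.hasDerivAt).deriv
    simp only [id, one_mul, zero_mul, add_zero, R0] at this
    exact this
  have hne : deriv (fun s => s * R s) 0 ≠ 0 := by rwa [hρ']
  have hθ := hρ.analyticAt_localInverse hne
  have hl := HasStrictDerivAt.eventually_left_inverse hρ.hasStrictDerivAt hne
  have hr := HasStrictDerivAt.eventually_right_inverse hρ.hasStrictDerivAt hne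
  have hd := (HasStrictDerivAt.to_localInverse hρ.hasStrictDerivAt hne).hasDerivAt.deriv
  set θ := HasStrictDerivAt.localInverse _ _ _ hρ.hasStrictDerivAt hne
  simp only [zero_mul] at hθ hr hd
  have θ0 : θ 0 = 0 := by simpa using hl.self_of_nhds
  refine ⟨θ, _, hθ, hρ, θ0, zero_mul _, by rw [hd]; exact inv_ne_zero hne, hl, ?_⟩
  have hc := hθ.continuousAt.tendsto
  rw [θ0] at hc
  filter_upwards [hr, hc.eventually eN, hc.eventually hRsq] with s h1 h2 h3
  have h2' : ξ (θ s) - ξ 0 = θ s ^ (1 + 1) • N (θ s) := h2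
  rw [← h3, smul_eq_mul, ← mul_pow, h1] at h2'
  rw [← h2']
  ring

/-- The odd part of the `k`-fold integral, with respect to `s²`, of a function with non-vanishing
derivative. -/
theorem exists_odd_part [CompleteSpace V] (k : ℕ) (Y : ℕ → ℂ → V)
    (hY : ∀ j ≤ k, AnalyticAt ℂ (Y j) 0)
    (hd : ∀ j < k, deriv (Y j) =ᶠ[𝓝 0] fun s => (2 * s) • Y (j + 1) s) :
    ∃ (K : ℂ → V) (c : ℂ), c ≠ 0 ∧ AnalyticAt ℂ K 0 ∧
      (∀ᶠ s in 𝓝 (0 : ℂ), Y 0 s - Y 0 (-s) = s ^ (2 * k + 1) • K s) ∧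
      K 0 = c • deriv (Y k) 0 := by
  have hneg : Tendsto (fun s : ℂ => -s) (𝓝 0) (𝓝 0) := by
    simpa using (continuous_neg (G := ℂ)).tendsto 0
  have hsymm : ∀ F : ℂ → V, AnalyticAt ℂ F 0 → AnalyticAt ℂ (fun s => F s - F (-s)) 0 :=
    fun F hF => hF.sub (AnalyticAt.fun_comp (f := fun s : ℂ => -s) (by simpa using hF)
      analyticAt_id.neg)
  have hder : ∀ F : ℂ → V, AnalyticAt ℂ F 0 → ∀ᶠ s in 𝓝 (0 : ℂ),
      deriv (fun s => F s - F (-s)) s = deriv F s + deriv F (-s) := by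
    intro F hF
    filter_upwards [hF.eventually_analyticAt, hneg.eventually hF.eventually_analyticAt] with s h1 h2
    have h3 := h1.differentiableAt.hasDerivAt.sub
      (h2.differentiableAt.hasDerivAt.scomp s (hasDerivAt_neg s))
    refine h3.deriv.trans ?_
    rw [neg_one_smul, sub_neg_eq_add]
  induction k generalizing Y with
  | zero =>
    obtain ⟨K, hK, e, K0⟩ := (hsymm _ (hY 0 le_rfl)).exists_eq_pow_smul_of_deriv (r := 0)
      (by simp) (hsymm _ (hY 0 le_rfl)).deriv (by simp)
    refine ⟨K, 2, two_ne_zero, hK, by simpa using! e, ?_⟩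
    have := (hder _ (hY 0 le_rfl)).self_of_nhds
    rw [this] at K0
    rw [two_smul]
    simpa using K0
  | succ k ih =>
    obtain ⟨K, c, hc, hK, e, K0⟩ := ih (fun j => Y (j + 1)) (fun j hj => hY _ (by omega))
      (fun j hj => hd _ (by omega))
    -- The derivative of Y_0(s) - Y_0(-s) is 2s (Y_1(s) - Y_1(-s)) = s^(2k+2) · 2K(s), so one
    -- integration adds two to the order.
    obtain ⟨N, hN, eN, N0⟩ := (hsymm _ (hY 0 (by omega))).exists_eq_pow_smul_of_deriv
      (r := 2 * k + 2) (M := fun s => (2 : ℂ) • K s) (by simp) (hK.const_smul) (by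
        have hd0 := hd 0 (by omega)
        filter_upwards [hder _ (hY 0 (by omega)), hd0, hneg.eventually hd0, e] with s h1 h2 h3 h4
        rw [h1, h2, h3, mul_neg, neg_smul, ← sub_eq_add_neg, ← smul_sub]
        simp only [zero_add] at h4 ⊢
        rw [h4, smul_smul, smul_smul]
        congr 1
        ring)
    refine ⟨N, (((2 * k + 2 : ℕ) : ℂ) + 1)⁻¹ * (2 * c), ?_, hN, by simpa [mul_add] using! eN, ?_⟩
    · exact mul_ne_zero (inv_ne_zero (Nat.cast_add_one_ne_zero _)) (mul_ne_zero two_ne_zero hc)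
    · rw [mul_smul, mul_smul, ← K0, ← N0, smul_smul, inv_mul_cancel₀ (Nat.cast_add_one_ne_zero _),
        one_smul]

end Analysis

/-! ### Secants of smooth surfaces, and surfaces through cuspidal curves -/

section Surfaces

variable {V : Type*} [NormedAddCommGroup V] [NormedSpace ℂ V]

/-- An immersion does not shrink distances near the given point by more than a constant factor. -/
theorem HasStrictFDerivAt.eventually_norm_sub_le {E : Type*} [NormedAddCommGroup E]
    [NormedSpace ℂ E] [FiniteDimensional ℂ E] {φ : E → V} {φ' : E →L[ℂ] V} {x : E}
    (h : HasStrictFDerivAt φ φ' x) (hi : Function.Injective φ') :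
    ∃ C : ℝ, 0 < C ∧ ∀ᶠ q in 𝓝 (x, x), ‖q.1 - q.2‖ ≤ C * ‖φ q.1 - φ q.2‖ := by
  obtain ⟨K, hK, hA⟩ := (φ' : E →ₗ[ℂ] V).exists_antilipschitzWith (LinearMap.ker_eq_bot.2 hi)
  have hb : ∀ d, ‖d‖ ≤ K * ‖φ' d‖ := fun d => by
    simpa using hA.le_mul_dist d 0
  have hK' : (0 : ℝ) < K := hK
  have hl := h.isLittleO.def (c := (2 * K : ℝ)⁻¹) (by positivity)
  refine ⟨2 * K, by positivity, ?_⟩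
  filter_upwards [hl] with q hq
  have h1 := hb (q.1 - q.2)
  have h2 : ‖φ' (q.1 - q.2)‖ ≤ ‖φ q.1 - φ q.2‖ + ‖φ q.1 - φ q.2 - φ' (q.1 - q.2)‖ := by
    have := norm_sub_le (φ q.1 - φ q.2) (φ q.1 - φ q.2 - φ' (q.1 - q.2))
    simpa using this
  have h3 : (K : ℝ) * ‖φ' (q.1 - q.2)‖ ≤
      K * (‖φ q.1 - φ q.2‖ + (2 * K : ℝ)⁻¹ * ‖q.1 - q.2‖) := by
    gcongr
    exact h2.trans (by gcongr)
  have h4 : (K : ℝ) * ((2 * K : ℝ)⁻¹ * ‖q.1 - q.2‖) = ‖q.1 - q.2‖ / 2 := by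
    field_simp
  linarith

end Surfaces

/-- Limits of secants of a surface are tangent to it. -/
theorem IsSmoothSurfaceAt.mem_of_tendsto_secant {S : Set (Fin n → ℂ)} {x : Fin n → ℂ}
    {P : Submodule ℂ (Fin n → ℂ)} (h : IsSmoothSurfaceAt S x P) {α : Type*} {l : Filter α}
    [l.NeBot] {f g : α → Fin n → ℂ} (hf : ∀ᶠ s in l, f s ∈ S) (hg : ∀ᶠ s in l, g s ∈ S)
    (hfx : Tendsto f l (𝓝 x)) (hgx : Tendsto g l (𝓝 x)) {c : α → ℂ} {v : Fin n → ℂ}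
    (hv : Tendsto (fun s => c s • (f s - g s)) l (𝓝 v)) : v ∈ P := by
  obtain ⟨φ, hφ, hφ0, hi, rfl, -, hU⟩ := h
  have hst := hφ.hasStrictFDerivAt
  obtain ⟨C, hC, hle⟩ := hst.eventually_norm_sub_le hi
  rw [nhds_prod_eq, eventually_prod_self_iff'] at hle
  obtain ⟨U, hU0, hUle⟩ := hle
  -- Points of S near x have parameters in U, and the lower bound on distances forces these
  -- parameters to tend to 0.
  have lift : ∀ f : α → Fin n → ℂ, (∀ᶠ s in l, f s ∈ S) → Tendsto f l (𝓝 x) →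
      ∃ u : α → ℂ × ℂ, (∀ᶠ s in l, u s ∈ U ∧ φ (u s) = f s) ∧ Tendsto u l (𝓝 0) := by
    intro f hf hfx
    have h1 : ∀ᶠ s in l, ∃ u ∈ U, φ u = f s :=
      tendsto_nhdsWithin_iff.2 ⟨hfx, hf⟩ (hU U hU0)
    obtain ⟨u, hu⟩ := h1.choice
    refine ⟨u, hu, ?_⟩
    have h2 : Tendsto (fun s => C * ‖f s - x‖) l (𝓝 0) := by
      have := ((hfx.sub_const x).norm).const_mul C
      simpa using this
    refine squeeze_zero_norm' ?_ h2
    filter_upwards [hu] with s hs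
    have := hUle (u s) hs.1 0 (mem_of_mem_nhds hU0)
    simpa [hs.2, hφ0] using this
  obtain ⟨u, hu, hu0⟩ := lift f hf hfx
  obtain ⟨w, hw, hw0⟩ := lift g hg hgx
  set φ' := fderiv ℂ φ 0
  -- Strict differentiability allows both ends of the secant to move; the error is o(u - w), and u -
  -- w = O(f - g).
  have ho : (fun s => f s - g s - φ' (u s - w s)) =o[l] fun s => f s - g s := by
    have h1 := hst.isLittleO.comp_tendsto (hu0.prodMk_nhds hw0)
    have h2 : (fun s => u s - w s) =O[l] fun s => f s - g s := by
      refine Asymptotics.IsBigO.of_bound C ?_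
      filter_upwards [hu, hw] with s h1 h2
      have := hUle _ h1.1 _ h2.1
      rwa [h1.2, h2.2] at this
    refine (h1.congr' ?_ (Eventually.of_forall fun s => rfl)).trans_isBigO h2
    filter_upwards [hu, hw] with s h1 h2
    simp [h1.2, h2.2]
  have ho2 : Tendsto (fun s => c s • (f s - g s - φ' (u s - w s))) l (𝓝 0) := by
    have h1 : (fun s => c s • (f s - g s - φ' (u s - w s))) =o[l]
      fun s => c s • (f s - g s) := (Asymptotics.isBigO_refl c l).smul_isLittleO ho
    exact (h1.trans_isBigO (hv.isBigO_one ℝ)).tendsto_zero_of_tendsto tendsto_const_nhds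
  have hlim := hv.sub ho2
  rw [sub_zero] at hlim
  have hcl : IsClosed (φ'.range : Set (Fin n → ℂ)) := Submodule.closed_of_finiteDimensional _
  refine hcl.mem_of_tendsto hlim (Eventually.of_forall fun s => ?_)
  rw [← smul_sub, sub_sub_cancel]
  exact Submodule.smul_mem _ _ ⟨_, rfl⟩

theorem IsSmoothSurfaceAt.finrank_eq {S : Set (Fin n → ℂ)} {x : Fin n → ℂ}
    {P : Submodule ℂ (Fin n → ℂ)} (h : IsSmoothSurfaceAt S x P) : Module.finrank ℂ P = 2 := by
  obtain ⟨φ, -, -, hi, rfl, -⟩ := h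
  refine (LinearMap.finrank_range_of_inj hi).trans ?_
  simp

/-- The image of a small neighbourhood under an immersion is a smooth surface. -/
theorem exists_isSmoothSurfaceAt_image {φ : ℂ × ℂ → (Fin n → ℂ)} (hφ : AnalyticAt ℂ φ 0)
    (hi : Function.Injective (fderiv ℂ φ 0)) :
    ∃ U ∈ 𝓝 (0 : ℂ × ℂ), IsSmoothSurfaceAt (φ '' U) (φ 0) (fderiv ℂ φ 0).range := by
  obtain ⟨C, hC, hle⟩ := hφ.hasStrictFDerivAt.eventually_norm_sub_le hi
  rw [nhds_prod_eq, eventually_prod_self_iff'] at hle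
  obtain ⟨U, hU0, hUle⟩ := hle
  refine ⟨U, hU0, φ, hφ, rfl, hi, rfl, ⟨U, hU0, le_rfl⟩, fun W hW => ?_⟩
  obtain ⟨ε, hε, hb⟩ := Metric.mem_nhds_iff.1 hW
  rw [mem_nhdsWithin_iff_exists_mem_nhds_inter]
  -- Within U, a value this close to φ 0 can only come from a parameter of norm less than ε, hence
  -- from W.
  refine ⟨Metric.ball (φ 0) (ε / C), Metric.ball_mem_nhds _ (by positivity), ?_⟩
  rintro _ ⟨hz, u, hu, rfl⟩
  refine ⟨u, hb ?_, rfl⟩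
  have h1 := hUle u hu 0 (mem_of_mem_nhds hU0)
  rw [mem_ball_iff_norm] at hz ⊢
  calc ‖u - 0‖ ≤ C * ‖φ u - φ 0‖ := h1
    _ < C * (ε / C) := by gcongr
    _ = ε := by field_simp

/-- The cuspidal curve `x + s² g(s²) + s^{m} h(s²)` lies on a smooth surface. -/
theorem exists_isSmoothSurfaceAt_of_even_odd {x : Fin n → ℂ} {g h : ℂ → Fin n → ℂ} {m : ℕ}
    (hm : m ≠ 0) (hg : AnalyticAt ℂ g 0) (hh : AnalyticAt ℂ h 0)
    (hi : LinearIndependent ℂ ![g 0, h 0]) :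
    ∃ (S : Set (Fin n → ℂ)) (P : Submodule ℂ (Fin n → ℂ)), IsSmoothSurfaceAt S x P ∧
      ∀ᶠ s in 𝓝 (0 : ℂ), x + s ^ 2 • g (s ^ 2) + s ^ m • h (s ^ 2) ∈ S := by
  set φ : ℂ × ℂ → Fin n → ℂ := fun y => x + y.1 • g y.1 + y.2 • h y.1 with hφ
  have hg' : AnalyticAt ℂ (fun y : ℂ × ℂ => g y.1) 0 :=
    AnalyticAt.fun_comp (f := fun y : ℂ × ℂ => y.1) hg analyticAt_fst
  have hh' : AnalyticAt ℂ (fun y : ℂ × ℂ => h y.1) 0 :=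
    AnalyticAt.fun_comp (f := fun y : ℂ × ℂ => y.1) hh analyticAt_fst
  have ha : AnalyticAt ℂ φ 0 :=
    (analyticAt_const.add (analyticAt_fst.smul hg')).add (analyticAt_snd.smul hh')
  have hd : ∀ y, fderiv ℂ φ 0 y = y.1 • g 0 + y.2 • h 0 := by
    intro y
    have h1 : HasFDerivAt φ _ 0 :=
      (((hasFDerivAt_fst (𝕜 := ℂ) (E := ℂ) (F := ℂ)).smul
        hg'.differentiableAt.hasFDerivAt).const_add x).add
      ((hasFDerivAt_snd (𝕜 := ℂ) (E := ℂ) (F := ℂ)).smul hh'.differentiableAt.hasFDerivAt)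
    rw [h1.fderiv]
    simp
  have hinj : Function.Injective (fderiv ℂ φ 0) := by
    rw [injective_iff_map_eq_zero]
    intro y hy
    rw [hd] at hy
    have := LinearIndependent.pair_iff.1 hi _ _ hy
    exact Prod.ext this.1 this.2
  obtain ⟨U, hU, hS⟩ := exists_isSmoothSurfaceAt_image ha hinj
  have h0 : φ 0 = x := by simp [hφ]
  rw [h0] at hS
  refine ⟨_, _, hS, ?_⟩
  have ht : Tendsto (fun s : ℂ => (s ^ 2, s ^ m)) (𝓝 0) (𝓝 0) := by
    have : ContinuousAt (fun s : ℂ => (s ^ 2, s ^ m)) 0 := by fun_prop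
    simpa [ContinuousAt, zero_pow hm, ← Prod.zero_eq_mk] using this
  filter_upwards [ht hU] with s hs
  exact ⟨_, hs, rfl⟩

/-! ### Curves with analytic jets over a fold of the base coordinate -/

/-- `γ` is a curve whose derivatives `X j` with respect to `ξ` (the component `a` of `γ`) are
analytic for `j ≤ k`, where `ξ` has a nondegenerate critical point at `0`, and the velocity of `X k`
at `0` spans the direction `e`. -/
structure IsJetCurve (γ : ℂ → Fin n → ℂ) (a : Fin n) (k : ℕ) (w e : Fin n → ℂ)
    (X : ℕ → ℂ → Fin n → ℂ) : Prop where
  zero_eq : X 0 = γ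
  one_eq : X 1 0 = w
  analyticAt : ∀ j ≤ k, AnalyticAt ℂ (X j) 0
  deriv_eq : ∀ j < k, deriv (X j) =ᶠ[𝓝 0] fun s => deriv (fun s => γ s a) s • X (j + 1) s
  exists_deriv_top : ∃ c : ℂ, c ≠ 0 ∧ deriv (X k) 0 = c • e
  deriv_base : deriv (fun s => γ s a) 0 = 0
  deriv_deriv_base : deriv (deriv fun s => γ s a) 0 ≠ 0

theorem finrank_span_pair {w e : Fin n → ℂ} (hi : LinearIndependent ℂ ![w, e]) :
    Module.finrank ℂ (Submodule.span ℂ {w, e}) = 2 := by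
  have := finrank_span_eq_card hi
  rwa [Matrix.range_cons, Matrix.range_cons, Matrix.range_empty, Set.union_empty,
    Set.singleton_union, Fintype.card_fin] at this

namespace IsJetCurve

variable {γ : ℂ → Fin n → ℂ} {a : Fin n} {k : ℕ} {w e : Fin n → ℂ} {X : ℕ → ℂ → Fin n → ℂ}
  (h : IsJetCurve γ a k w e X)
include h

theorem analyticAt_curve : AnalyticAt ℂ γ 0 := h.zero_eq ▸ h.analyticAt 0 (Nat.zero_le k)

theorem analyticAt_base : AnalyticAt ℂ (fun s => γ s a) 0 :=
  analyticAt_pi_iff.1 h.analyticAt_curve a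

theorem eventually_deriv_base_ne_zero : ∀ᶠ s in 𝓝[≠] (0 : ℂ), deriv (fun s => γ s a) s ≠ 0 :=
  h.analyticAt_base.deriv.differentiableAt.hasDerivAt.eventually_ne h.deriv_deriv_base

/-- Away from 0 the first jet `X 1` is γ' divided by the derivative of the base component, and it
extends continuously to w. -/
theorem isTangentLine (hk : 0 < k) (hw : w ≠ 0) : IsTangentLine γ (Submodule.span ℂ {w}) := by
  refine ⟨w, hw, rfl, fun s => (deriv (fun s => γ s a) s)⁻¹, ?_⟩
  have h1 : Tendsto (X 1) (𝓝[≠] 0) (𝓝 w) := by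
    rw [← h.one_eq]
    exact (h.analyticAt 1 hk).continuousAt.tendsto.mono_left nhdsWithin_le_nhds
  refine h1.congr' ?_
  have h2 := h.deriv_eq 0 hk
  rw [h.zero_eq] at h2
  filter_upwards [h.eventually_deriv_base_ne_zero, nhdsWithin_le_nhds h2] with s h3 h4
  rw [h4, smul_smul, inv_mul_cancel₀ h3, one_smul]

/-- The normal form of the curve in a suitable parameter. -/
theorem exists_normal_form (hk : 0 < k) :
    ∃ (θ ρ : ℂ → ℂ) (N K : ℂ → Fin n → ℂ) (c : ℂ), Tendsto θ (𝓝 0) (𝓝 0) ∧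
      Tendsto ρ (𝓝 0) (𝓝 0) ∧ (∀ᶠ s in 𝓝 0, θ (ρ s) = s) ∧ AnalyticAt ℂ N 0 ∧
      AnalyticAt ℂ K 0 ∧ N 0 = w ∧ c ≠ 0 ∧ K 0 = c • e ∧
      (∀ᶠ s in 𝓝 0, γ (θ s) - γ 0 = s ^ 2 • N s) ∧
      ∀ᶠ s in 𝓝 0, γ (θ s) - γ (θ (-s)) = s ^ (2 * k + 1) • K s := by
  obtain ⟨θ, ρ, hθ, hρ, θ0, ρ0, θ', hl, hsq⟩ :=
    h.analyticAt_base.exists_reparam_sq h.deriv_base h.deriv_deriv_base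
  have hθt : Tendsto θ (𝓝 0) (𝓝 0) := by simpa [ContinuousAt, θ0] using hθ.continuousAt
  have hρt : Tendsto ρ (𝓝 0) (𝓝 0) := by simpa [ContinuousAt, ρ0] using hρ.continuousAt
  -- Differentiating x_a ∘ θ = x_a(0) + s² turns integration against dx_a into integration against
  -- 2s ds.
  have hbase : ∀ᶠ s in 𝓝 0, deriv θ s * deriv (fun s => γ s a) (θ s) = 2 * s := by
    have h1 := EventuallyEq.deriv (show (fun s => γ (θ s) a) =ᶠ[𝓝 0] fun s => γ 0 a + s ^ 2 from hsq)
    filter_upwards [h1, hθ.eventually_analyticAt,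
      hθt.eventually h.analyticAt_base.eventually_analyticAt] with s h2 h3 h4
    have h5 := (h4.differentiableAt.hasDerivAt.scomp s h3.differentiableAt.hasDerivAt).deriv
    change deriv (fun s => γ (θ s) a) s = _ at h5
    rw [h5] at h2
    rw [← smul_eq_mul, h2]
    simp
  have hchain : ∀ j ≤ k, ∀ᶠ s in 𝓝 0,
      deriv (fun s => X j (θ s)) s = deriv θ s • deriv (X j) (θ s) := by
    intro j hj
    filter_upwards [hθ.eventually_analyticAt,
      hθt.eventually (h.analyticAt j hj).eventually_analyticAt] with s h3 h4
    exact (h4.differentiableAt.hasDerivAt.scomp s h3.differentiableAt.hasDerivAt).deriv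
  have hY : ∀ j ≤ k, AnalyticAt ℂ (fun s => X j (θ s)) 0 := fun j hj =>
    AnalyticAt.fun_comp (by rw [θ0]; exact h.analyticAt j hj) hθ
  have hd : ∀ j < k, deriv (fun s => X j (θ s)) =ᶠ[𝓝 0] fun s => (2 * s) • X (j + 1) (θ s) := by
    intro j hj
    filter_upwards [hchain j hj.le, hθt.eventually (h.deriv_eq j hj), hbase] with s h1 h2 h3
    rw [h1, h2, smul_smul, h3]
  obtain ⟨K, c, hc, hK, eK, K0⟩ := exists_odd_part k (fun j s => X j (θ s)) hY hd
  obtain ⟨N, hN, eN, N0⟩ := ((hY 0 hk.le).sub (analyticAt_const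
    (v := X 0 0))).exists_eq_pow_smul_of_deriv (r := 1) (M := (2 : ℂ) • fun s => X 1 (θ s))
    (by simp [θ0]) (hY 1 hk).const_smul (by
      refine EventuallyEq.trans (Eventually.of_forall fun s => deriv_sub_const _)
        ((hd 0 hk).trans (Eventually.of_forall fun s => ?_))
      simp only [zero_add, pow_one, Pi.smul_apply, smul_smul]
      rw [mul_comm])
  obtain ⟨μ, hμ, hμe⟩ := h.exists_deriv_top
  rw [h.zero_eq] at eN
  simp only [h.zero_eq] at eK
  refine ⟨θ, ρ, N, K, c * (deriv θ 0 * μ), hθt, hρt, hl, hN, hK, ?_,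
    mul_ne_zero hc (mul_ne_zero θ' hμ), ?_, eN, eK⟩
  · have : ((1 : ℕ) : ℂ) + 1 = 2 := by norm_num
    rw [this, Pi.smul_apply, θ0, h.one_eq] at N0
    exact smul_right_injective _ two_ne_zero N0
  · rw [K0, (hchain k le_rfl).self_of_nhds, θ0, hμe, mul_smul, mul_smul]

/-- The even and odd parts of the curve in the normal parameter are s² and s^(2k+1) times analytic
functions of s², whose values at 0 are w and a non-zero multiple of e. -/
theorem exists_surface (hk : 0 < k) (hi : LinearIndependent ℂ ![w, e]) :
    ∃ (S : Set (Fin n → ℂ)) (P : Submodule ℂ (Fin n → ℂ)), IsSmoothSurfaceAt S (γ 0) P ∧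
      ∀ᶠ s in 𝓝 (0 : ℂ), γ s ∈ S := by
  obtain ⟨θ, ρ, N, K, c, hθ, hρ, hl, hN, hK, N0, hc, K0, eN, eK⟩ := h.exists_normal_form hk
  have hneg : Tendsto (fun s : ℂ => -s) (𝓝 0) (𝓝 0) := by
    simpa using (continuous_neg (G := ℂ)).tendsto 0
  have hsymm : ∀ {F : ℂ → Fin n → ℂ}, AnalyticAt ℂ F 0 → AnalyticAt ℂ (fun s => F (-s)) 0 :=
    fun hF => AnalyticAt.fun_comp (f := fun s : ℂ => -s) (by simpa using hF) analyticAt_id.neg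
  obtain ⟨g, hg, eg⟩ := ((hN.add (hsymm hN)).const_smul (c := (2⁻¹ : ℂ))).exists_comp_sq_of_even
    (Eventually.of_forall fun s => by simp [add_comm])
  -- `K` is even: γ(θ(s)) - γ(θ(-s)) and s^(2k+1) both change sign under s ↦ -s.
  obtain ⟨f, hf, ef⟩ := (hK.const_smul (c := (2⁻¹ : ℂ))).exists_comp_sq_of_even (by
    filter_upwards [eK, hneg.eventually eK] with s h1 h2
    by_cases hs : s = 0
    · simp [hs]
    rw [neg_neg, Odd.neg_pow ⟨k, rfl⟩, neg_smul, eq_neg_iff_add_eq_zero, ← eq_neg_iff_add_eq_zero,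
      ← neg_sub (γ (θ s)), neg_inj, h1] at h2
    have := smul_right_injective _ (pow_ne_zero (2 * k + 1) hs) h2
    simp [this])
  have g0 : g 0 = w := by
    have := eg.self_of_nhds
    simp only [Pi.smul_apply, Pi.add_apply, neg_zero, N0] at this
    rw [zero_pow two_ne_zero, ← two_smul ℂ w, smul_smul, inv_mul_cancel₀ two_ne_zero,
      one_smul] at this
    exact this.symm
  have f0 : f 0 = (2⁻¹ * c) • e := by
    have := ef.self_of_nhds
    simp only [Pi.smul_apply, K0] at this
    rw [zero_pow two_ne_zero, smul_smul] at this
    exact this.symm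
  have hi' : LinearIndependent ℂ ![g 0, f 0] := by
    rw [g0, f0]
    rw [LinearIndependent.pair_iff] at hi ⊢
    intro s t hst
    rw [smul_smul] at hst
    have := hi _ _ hst
    refine ⟨this.1, ?_⟩
    simpa [hc] using this.2
  obtain ⟨S, P, hS, hmem⟩ := exists_isSmoothSurfaceAt_of_even_odd (x := γ 0) (m := 2 * k + 1)
    (by omega) hg hf hi'
  refine ⟨S, P, hS, ?_⟩
  have hall : ∀ᶠ s in 𝓝 0, γ (θ s) ∈ S := by
    filter_upwards [hmem, eN, hneg.eventually eN, eK, eg, ef] with s h1 h2 h3 h4 h5 h6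
    convert! h1 using 1
    rw [← h5, ← h6]
    simp only [Pi.smul_apply, Pi.add_apply]
    rw [smul_comm, smul_add, smul_comm _ (2⁻¹ : ℂ), ← h4]
    rw [neg_sq] at h3
    rw [← h2, ← h3]
    module
  -- Return to the original parameter through ρ, of which θ is a left inverse.
  filter_upwards [hρ.eventually hall, hl] with s h1 h2
  rwa [h2] at h1

/-- The secants to γ(0) give w and those between parameters s and -s give e; two independent vectors
fill a plane. -/
theorem eq_span_of_surface (hk : 0 < k) (hi : LinearIndependent ℂ ![w, e])
    {S : Set (Fin n → ℂ)} {P : Submodule ℂ (Fin n → ℂ)} (hS : IsSmoothSurfaceAt S (γ 0) P)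
    (hmem : ∀ᶠ s in 𝓝 (0 : ℂ), γ s ∈ S) : P = Submodule.span ℂ {w, e} := by
  obtain ⟨θ, ρ, N, K, c, hθ, hρ, hl, hN, hK, N0, hc, K0, eN, eK⟩ := h.exists_normal_form hk
  have hneg : Tendsto (fun s : ℂ => -s) (𝓝[≠] 0) (𝓝 0) := by
    have : Tendsto (fun s : ℂ => -s) (𝓝 0) (𝓝 0) := by
      simpa using (continuous_neg (G := ℂ)).tendsto 0
    exact this.mono_left nhdsWithin_le_nhds
  have hθ' : Tendsto θ (𝓝[≠] 0) (𝓝 0) := hθ.mono_left nhdsWithin_le_nhds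
  have hγ : Tendsto γ (𝓝 0) (𝓝 (γ 0)) := h.analyticAt_curve.continuousAt
  have hw : w ∈ P := by
    refine hS.mem_of_tendsto_secant (l := 𝓝[≠] (0 : ℂ)) (f := fun s => γ (θ s))
      (g := fun _ => γ 0) (c := fun s => (s ^ 2)⁻¹) (hθ'.eventually hmem)
      (Eventually.of_forall fun _ => hmem.self_of_nhds) (hγ.comp hθ') tendsto_const_nhds ?_
    have h1 : Tendsto N (𝓝[≠] 0) (𝓝 w) := by
      rw [← N0]
      exact hN.continuousAt.tendsto.mono_left nhdsWithin_le_nhds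
    refine h1.congr' ?_
    filter_upwards [self_mem_nhdsWithin, nhdsWithin_le_nhds eN] with s hs h2
    rw [h2, smul_smul, inv_mul_cancel₀ (pow_ne_zero _ hs), one_smul]
  have he : c • e ∈ P := by
    refine hS.mem_of_tendsto_secant (l := 𝓝[≠] (0 : ℂ)) (f := fun s => γ (θ s))
      (g := fun s => γ (θ (-s))) (c := fun s => (s ^ (2 * k + 1))⁻¹) (hθ'.eventually hmem)
      ((hθ.comp hneg).eventually hmem) (hγ.comp hθ') (hγ.comp (hθ.comp hneg)) ?_
    have h1 : Tendsto K (𝓝[≠] 0) (𝓝 (c • e)) := by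
      rw [← K0]
      exact hK.continuousAt.tendsto.mono_left nhdsWithin_le_nhds
    refine h1.congr' ?_
    filter_upwards [self_mem_nhdsWithin, nhdsWithin_le_nhds eK] with s hs h2
    rw [h2, smul_smul, inv_mul_cancel₀ (pow_ne_zero _ hs), one_smul]
  have he' : e ∈ P := (Submodule.smul_mem_iff P hc).1 he
  refine (Submodule.eq_of_le_of_finrank_eq ?_ ?_).symm
  · rw [Submodule.span_le]
    rintro z (rfl | rfl)
    exacts [hw, he']
  · rw [hS.finrank_eq, finrank_span_pair hi]

end IsJetCurve

/-! ### Jet charts of the Monster and the RVT code -/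

/-- The chart of the Monster whose coordinates are the derivatives with respect to the coordinate
`a`. -/
def diagChart (a : Fin n) : ∀ k, (monster n k).Chart
  | 0 => ()
  | k + 1 => (diagChart a k, a)

namespace MPt

/-- The point lies in the domain of the chart `diagChart a`. -/
abbrev InDiag (a : Fin n) {k : ℕ} (q : MPt n k) : Prop := q ∈ (monster n k).dom (diagChart a k)

/-- The chart (i, a) keeps f_a as its a-th coframe function, so on every level that function is
still the coordinate x_a of ℂ^n. -/
theorem cof_coord_diagChart (a : Fin n) {m : ℕ} (q : MPt n m) :
    (monster n m).cof (diagChart a m) a ((monster n m).coord (diagChart a m) q) =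
      q.basePoint a := by
  induction m with
  | zero => rfl
  | succ m ih =>
    exact (prolong_cof_self (monster n m) (diagChart a m) a _).trans (ih q.down)

theorem lastLetter_eq_V {k : ℕ} {p : MPt n (k + 1)} (h : p.lastLetter = RVT.V) :
    p.IsVertical := by
  unfold lastLetter at h
  split_ifs at h
  assumption

theorem lastLetter_eq_R {k : ℕ} {p : MPt n (k + 1)} (h : p.lastLetter = RVT.R) :
    ¬ p.IsVertical ∧ ¬ p.IsCritical := by
  unfold lastLetter at h
  split_ifs at h with h1 h2
  exact ⟨h1, h2⟩

theorem code_eq_append {k : ℕ} {p : MPt n (k + 1)} {l : List RVT} {x : RVT}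
    (h : p.code = l ++ [x]) : p.down.code = l ∧ p.lastLetter = x := by
  have := List.append_inj' (show p.down.code ++ [p.lastLetter] = l ++ [x] from h) rfl
  exact ⟨this.1, List.singleton_inj.1 this.2⟩

theorem isVertical_iff {m : ℕ} {a : Fin n} {q : MPt n (m + 2)} (hq : q.down.InDiag a) :
    q.IsVertical ↔
      (monster n m).prolong.homCoord q.pair ⟨(diagChart a m, a), hq⟩ a = 0 :=
  (monsterFrame n m).lineIn_subset_verticalSpace_iff hq

/-- The line at level one has some non-zero component a. Every later line is non-vertical, which is
exactly dx_a ≠ 0 on it, so the same a works throughout. -/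
theorem exists_inDiag {m : ℕ} (q : MPt n (m + 1)) (hq : q.code = List.replicate (m + 1) RVT.R) :
    ∃ a : Fin n, q.InDiag a := by
  induction m with
  | zero =>
    obtain ⟨a, ha⟩ := (affineFrame n).homCoord_ne_zero q.pair ⟨(), trivial⟩
    exact ⟨a, trivial, ha⟩
  | succ m ih =>
    rw [List.replicate_succ'] at hq
    obtain ⟨h1, h2⟩ := code_eq_append hq
    obtain ⟨a, ha⟩ := ih q.down h1
    exact ⟨a, ha, fun h => (lastLetter_eq_R h2).1 ((isVertical_iff ha).2 h)⟩

/-- The direction of the line `firstLine`, normalized to have `a`-th component `1`. -/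
noncomputable def firstDir (a : Fin n) : ∀ {k : ℕ}, MPt n k → (Fin n → ℂ)
  | 0, _ => 0
  | 1, p => affineLift a ((affineSpace n).projAtlas.coord ((), a) p.pair).2
  | _ + 2, p => firstDir a p.down

theorem firstDir_self (a : Fin n) {k : ℕ} (p : MPt n (k + 1)) : firstDir a p a = 1 := by
  induction k with
  | zero => exact affineLift_self a _
  | succ k ih => exact ih p.down

theorem map_lineIn_affineSpace {a : Fin n} (q : (affineSpace n).ProjPt)
    (hq : q ∈ (affineSpace n).projAtlas.dom ((), a)) :
    ((affineSpace n).lineIn q.line).map ((LinearMap.proj (R := ℂ)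
      (φ := fun i : (affineSpace n).ChartAt q.base => (affineSpace n).Model i.1)
      ⟨(), trivial⟩).comp ((affineSpace n).toAtlas.Tangent q.base).subtype) =
      Submodule.span ℂ {affineLift a ((affineSpace n).projAtlas.coord ((), a) q).2} := by
  obtain ⟨v, hv, e, ev⟩ := (affineFrame n).exists_mk_eq hq
  rw [e, Frame.lineIn_mk, Submodule.map_span, Set.image_singleton]
  exact congrArg (fun w => Submodule.span ℂ {w}) ev

theorem firstLine_eq_span {a : Fin n} {k : ℕ} (p : MPt n (k + 1)) (hp : p.InDiag a) :
    p.firstLine = Submodule.span ℂ {firstDir a p} := by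
  induction k with
  | zero =>
    exact map_lineIn_affineSpace p.pair hp
  | succ k ih => exact ih p.down hp.1

end MPt

open MPt

/-! ### Jets of a curve from its prolongations -/

/-- The functions `X j` are the derivatives of `γ` with respect to its component `a`, and `τ` is
the curve in the Monster with these coordinates. -/
structure IsJetFamily (γ : ℂ → Fin n → ℂ) (a : Fin n) (m : ℕ) (τ : ℂ → MPt n m)
    (X : ℕ → ℂ → Fin n → ℂ) : Prop where
  zero_eq : X 0 = γ
  one_eq : 0 < m → X 1 0 = firstDir a (τ 0)
  analyticAt : ∀ j ≤ m, AnalyticAt ℂ (X j) 0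
  deriv_eq : ∀ j < m, deriv (X j) =ᶠ[𝓝 0] fun s => deriv (fun s => γ s a) s • X (j + 1) s
  top_eq : ∀ c ≠ a, (fun s => X m s c) =ᶠ[𝓝 0] fun s =>
    (monster n m).cof (diagChart a m) c ((monster n m).coord (diagChart a m) (τ s))
  top_base : 0 < m → ∃ x : ℂ, ∀ s, X m s a = x
  base_eq : (fun s => γ s a) =ᶠ[𝓝 0] fun s => (τ s).basePoint a

theorem deriv_apply_of_analyticAt {F : ℂ → Fin n → ℂ} (hF : AnalyticAt ℂ F 0) (c : Fin n) :
    ∀ᶠ s in 𝓝 0, deriv F s c = deriv (fun s => F s c) s := by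
  filter_upwards [hF.eventually_analyticAt] with s hs
  exact (hasDerivAt_pi.1 hs.differentiableAt.hasDerivAt c).deriv.symm

/-- By `deriv_cof_eq`, each new fibre coordinate of the prolonged curve is the derivative with
respect to x_a of the preceding one, and it is analytic because the prolonged curve is. -/
theorem exists_isJetFamily {γ : ℂ → Fin n → ℂ} (hγ : AnalyticAt ℂ γ 0) (a : Fin n) {m : ℕ}
    {τ : ℂ → MPt n m} (hτ : IsIteratedProlongation γ m τ) (h0 : (τ 0).InDiag a) :
    ∃ X, IsJetFamily γ a m τ X := by
  induction m with
  | zero =>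
    obtain rfl : τ = γ := hτ
    exact ⟨fun _ => τ, rfl, fun h => absurd h (lt_irrefl 0), fun _ _ => hγ,
      fun j hj => absurd hj (Nat.not_lt_zero j), fun c _ => EventuallyEq.rfl,
      fun h => absurd h (lt_irrefl 0), EventuallyEq.rfl⟩
  | succ m ih =>
    obtain ⟨τ', hτ', hp⟩ := hτ
    have h0' : τ 0 ∈ (monster n m).projAtlas.dom (diagChart a m, a) := h0
    obtain ⟨X, hX⟩ := ih hτ' (hp.mem_dom h0')
    have hu := Frame.analyticAt_affineLift_coord hp.2.1 h0'
    set u : ℂ → Fin n → ℂ := fun s =>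
      affineLift a ((monster n m).projAtlas.coord (diagChart a m, a) (τ s)).2 with hudef
    -- `affineLift` puts 1 in the slot a on every level, but the derivatives of x_a with respect to
    -- itself are 1 and then 0, so that slot is corrected.
    set Y : ℂ → Fin n → ℂ := fun s => Function.update (u s) a (if m = 0 then 1 else 0) with hYdef
    have Ya : ∀ s, Y s a = if m = 0 then 1 else 0 := fun s => by simp [hYdef]
    have Yc : ∀ c ≠ a, ∀ s, Y s c = u s c := fun c hc s => by simp [hYdef, hc]
    have hY : AnalyticAt ℂ Y 0 := by
      rw [analyticAt_pi_iff]
      intro c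
      by_cases hc : c = a
      · subst hc
        exact analyticAt_const.congr (Eventually.of_forall fun s => (Ya s).symm)
      · exact (hu c).congr (Eventually.of_forall fun s => (Yc c hc s).symm)
    have hbase : (fun s => (monster n m).cof (diagChart a m) a
        ((monster n m).coord (diagChart a m) (τ' s))) =ᶠ[𝓝 0] fun s => γ s a := by
      refine EventuallyEq.trans (Eventually.of_forall fun s => ?_) hX.base_eq.symm
      exact cof_coord_diagChart a (τ' s)
    have htop : deriv (X m) =ᶠ[𝓝 0] fun s => deriv (fun s => γ s a) s • Y s := by
      have hall : ∀ c, ∀ᶠ s in 𝓝 0, deriv (X m) s c = deriv (fun s => γ s a) s * Y s c := by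
        intro c
        by_cases hc : c = a
        · subst hc
          filter_upwards [deriv_apply_of_analyticAt (hX.analyticAt m le_rfl) c] with s h1
          rw [h1, Ya]
          split_ifs with hm
          · subst hm
            rw [hX.zero_eq, mul_one]
          · obtain ⟨x, hx⟩ := hX.top_base (Nat.pos_of_ne_zero hm)
            simp only [hx]
            simp
        · filter_upwards [deriv_apply_of_analyticAt (hX.analyticAt m le_rfl) c,
            (hX.top_eq c hc).deriv, (monsterFrame n m).deriv_cof_eq hp h0' c, hbase.deriv]
            with s h1 h2 h3 h4
          rw [h1, h2, h3, h4, Yc c hc, mul_comm]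
      filter_upwards [eventually_all.2 hall] with s hs
      funext c
      exact hs c
    refine ⟨fun j => if j ≤ m then X j else Y, by simpa using hX.zero_eq, fun _ => ?_, ?_, ?_, ?_,
      fun _ => ⟨if m = 0 then 1 else 0, fun s => ?_⟩, ?_⟩
    · rcases m with _ | m
      · rw [if_neg (by omega)]
        funext c
        by_cases hc : c = a
        · subst hc
          rw [Ya, firstDir_self]
          rfl
        · exact Yc c hc 0
      · rw [if_pos (by omega), hX.one_eq (Nat.succ_pos m)]
        exact congrArg (firstDir a) hp.2.2.1.symm
    · intro j hj
      split_ifs with h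
      exacts [hX.analyticAt j h, hY]
    · intro j hj
      have hjm : j ≤ m := Nat.lt_succ_iff.1 hj
      rw [if_pos hjm]
      rcases hjm.lt_or_eq with h | rfl
      · rw [if_pos (show j + 1 ≤ m from h)]
        exact hX.deriv_eq j h
      · rw [if_neg (by omega)]
        exact htop
    · intro c hc
      rw [if_neg (by omega)]
      refine Eventually.of_forall fun s => ?_
      exact (Yc c hc s).trans ((affineLift_of_ne hc _).trans
        (prolong_cof_of_ne (monster n m) (diagChart a m) hc
          ((monster n m).projAtlas.coord (diagChart a m, a) (τ s))).symm)
    · rw [if_neg (by omega), Ya]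
    · refine hX.base_eq.trans ?_
      filter_upwards [hp.base_eq] with s hs
      exact congrArg (fun q : MPt n m => q.basePoint a) hs.symm

/-! ### Critical directions at a vertical point -/

namespace MPt

theorem isCriticalDirection_of_mem {k : ℕ} {p : MPt n k} {v : (monster n k).dist p} {hv : v ≠ 0}
    {S : Set (MPt n k)} (hS : IsBabyMonster n k S) (hp : p ∈ S)
    (h : ∀ c : ℂ, c • v.1 ∈ Atlas.tangentOfSubset S p) :
    IsCriticalDirection p (Projectivization.mk ℂ v hv) := by
  refine ⟨_, ⟨S, hS, hp, rfl⟩, fun w hw => ?_⟩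
  obtain ⟨c, rfl⟩ := Frame.mem_lineIn_mk.1 hw
  exact ⟨Submodule.smul_mem _ c v.2, h c⟩

theorem IsCriticalDirection.exists_mem {k : ℕ} {p : MPt n k} {v : (monster n k).dist p}
    {hv : v ≠ 0} (h : IsCriticalDirection p (Projectivization.mk ℂ v hv)) :
    ∃ S, IsBabyMonster n k S ∧ p ∈ S ∧ v.1 ∈ Atlas.tangentOfSubset S p := by
  obtain ⟨_, ⟨S, hS, hp, rfl⟩, hl⟩ := h
  exact ⟨S, hS, hp, (hl (Frame.mem_lineIn_mk.2 ⟨1, (one_smul ℂ _).symm⟩)).2⟩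

/-- A line tangent to a prolonged baby Monster makes the point critical. -/
theorem isCritical_of_mem_prolongSubset {k : ℕ} {p : MPt n (k + 1)} {S : Set (MPt n k)}
    (hS : IsBabyMonster n k S) (hp : p.pair ∈ (monster n k).prolongSubset S) : p.IsCritical :=
  ⟨_, ⟨S, hS, hp.1, rfl⟩, fun _ hw => ⟨Submodule.map_subtype_le _ _ hw, hp.2 hw⟩⟩

end MPt

/-- The point `p` is vertical over a point of the domain of `diagChart a`, and its line has
non-zero `b`-th coframe coordinate. -/
structure IsVerticalChart {k : ℕ} (p : MPt n (k + 2)) (a b : Fin n) : Prop where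
  ne : a ≠ b
  mem : p.pair ∈ (monster n k).prolong.projAtlas.dom ((diagChart a k, a), b)
  eq_zero : ((monster n k).prolong.projAtlas.coord ((diagChart a k, a), b) p.pair).2 ⟨a, ne⟩ = 0

namespace IsVerticalChart

variable {k : ℕ} {p : MPt n (k + 2)} {a b : Fin n} (h : IsVerticalChart p a b)

/-- The coframe coordinates of a tangent vector at `p`. -/
noncomputable def cofAt (c : Fin n)
    (v : (monster n k).prolong.projAtlas.Tangent p.pair) : ℂ :=
  (monster n k).prolong.prolong.cof ((diagChart a k, a), b) c (v.1 ⟨_, h.mem⟩)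

theorem cofAt_smul (t : ℂ) (c : Fin n) (v : (monster n k).prolong.projAtlas.Tangent p.pair) : h.cofAt c (t • v) = t * h.cofAt c v :=
  map_smul ((monster n k).prolong.prolong.cof ((diagChart a k, a), b) c) t (v.1 ⟨_, h.mem⟩)

include h in
theorem mem_fiber_iff {v : (monster n k).prolong.projAtlas.Tangent p.pair}
    (hv : v ∈ (monster n k).prolong.prolong.dist p.pair) :
    v ∈ Atlas.tangentOfSubset (M := (monster n k).prolong.projAtlas)
      {q | q.base = p.pair.base} p.pair ↔ h.cofAt b v = 0 := by
  rw [(monsterFrame n k).prolong.tangentOfSubset_fiber h.mem]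
  exact (monsterFrame n k).prolong.mem_verticalSpace_iff_cof h.mem hv

theorem cofAt_eq (v : (monster n k).prolong.projAtlas.Tangent p.pair) :
    h.cofAt a v = (v.1 ⟨_, h.mem⟩).2 ⟨a, h.ne⟩ :=
  prolong_cof_of_ne (monster n k).prolong (diagChart a k, a) h.ne _

include h in
theorem mem_prolong_fiber_iff {v : (monster n k).prolong.projAtlas.Tangent p.pair}
    (hv : v ∈ (monster n k).prolong.prolong.dist p.pair) :
    v ∈ Atlas.tangentOfSubset (M := (monster n k).prolong.projAtlas)
      ((monster n k).prolong.prolongSubset {q | q.base = p.pair.base.base}) p.pair ↔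
      h.cofAt a v = 0 := by
  rw [cofAt_eq]
  exact ⟨(monsterFrame n k).tangentOfSubset_prolong_fiber h.ne h.mem,
    (monsterFrame n k).mem_tangentOfSubset_prolong_fiber h.ne h.mem h.eq_zero hv⟩

/-- The critical directions at `p`. -/
theorem isCriticalDirection_iff (hp : ¬ p.down.IsCritical) {v : (monster n (k + 2)).dist p}
    {hv : v ≠ 0} : IsCriticalDirection p (Projectivization.mk ℂ v hv) ↔
      h.cofAt b v.1 = 0 ∨ h.cofAt a v.1 = 0 := by
  constructor
  · intro hc
    obtain ⟨S, hS, hpS, hvS⟩ := hc.exists_mem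
    cases hS with
    | fiber q =>
      obtain rfl : p.down = q := hpS
      exact Or.inl ((h.mem_fiber_iff v.2).1 hvS)
    | prolong S' hS' =>
      have h1 : p.down ∈ S' := hpS.1
      cases hS' with
      | fiber q =>
        obtain rfl : p.down.down = q := h1
        exact Or.inr ((h.mem_prolong_fiber_iff v.2).1 hvS)
      -- A baby Monster born further down would contain p.down as a point of its prolongation and
      -- make it critical.
      | prolong S'' hS'' => exact absurd (isCritical_of_mem_prolongSubset hS'' h1) hp
  · rintro (h0 | h0)
    · refine isCriticalDirection_of_mem (IsBabyMonster.fiber p.down) rfl fun c => ?_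
      refine (h.mem_fiber_iff (Submodule.smul_mem _ c v.2)).2 ?_
      exact (h.cofAt_smul c b v.1).trans ((congrArg (c * ·) h0).trans (mul_zero c))
    · refine isCriticalDirection_of_mem (IsBabyMonster.prolong _ (IsBabyMonster.fiber p.down.down))
        ?_ fun c => ?_
      · exact ((monsterFrame n k).mem_prolongSubset_fiber_iff h.ne h.mem _).2 ⟨rfl, h.eq_zero⟩
      · refine (h.mem_prolong_fiber_iff (Submodule.smul_mem _ c v.2)).2 ?_
        exact (h.cofAt_smul c a v.1).trans ((congrArg (c * ·) h0).trans (mul_zero c))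

/-- The second direction of the flag. -/
noncomputable def dir (_ : IsVerticalChart p a b) : Fin n → ℂ :=
  affineLift b ((monster n k).prolong.projAtlas.coord ((diagChart a k, a), b) p.pair).2

theorem dir_a : h.dir a = 0 := (affineLift_of_ne h.ne _).trans h.eq_zero

theorem dir_b : h.dir b = 1 := affineLift_self b _

/-- The components a and b of the two vectors form a triangular matrix: (1, ∗) and (0, 1). -/
theorem linearIndependent : LinearIndependent ℂ ![firstDir a p, h.dir] := by
  rw [LinearIndependent.pair_iff]
  intro s t hst
  have h1 := congrFun hst a
  have h2 := congrFun hst b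
  simp only [Pi.add_apply, Pi.smul_apply, h.dir_a, h.dir_b, firstDir_self, smul_eq_mul, mul_one,
    mul_zero, add_zero, Pi.zero_apply] at h1 h2
  rw [h1, zero_mul, zero_add] at h2
  exact ⟨h1, h2⟩

end IsVerticalChart

/-! ### Members of Germ(p) as jet curves -/

namespace IsVerticalChart

variable {k : ℕ} {p : MPt n (k + 2)} {a b : Fin n} (h : IsVerticalChart p a b)

/-- The members of `Germ(p)` are the projections of curves in jet space. -/
theorem exists_isJetCurve (hp : ¬ p.down.IsCritical) {γ : ℂ → Fin n → ℂ} (hγ : γ ∈ p.Germ) :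
    ∃ X, IsJetCurve γ a (k + 1) (firstDir a p) h.dir X := by
  obtain ⟨han, -, σ, ⟨τ, hτ, hσ⟩, v, hv, hvel, hreg⟩ := hγ
  obtain rfl : σ 0 = p := hvel.1
  rw [h.isCriticalDirection_iff hp, not_or] at hreg
  have hmem := h.mem
  have hbase0 : (σ 0).base = τ 0 := hσ.2.2.1
  have hτ0 : (τ 0).InDiag a := hσ.mem_dom hmem
  obtain ⟨X, hX⟩ := exists_isJetFamily han a hτ hτ0
  set C : Fin n → ℂ → ℂ := fun c s => (monster n k).prolong.prolong.cof ((diagChart a k, a), b) c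
    ((monster n k).prolong.projAtlas.coord ((diagChart a k, a), b) (σ s)) with hC
  set y : Fin n → ℂ → ℂ := fun c s => (monster n k).prolong.cof (diagChart a k, a) c
    ((monster n k).projAtlas.coord (diagChart a k, a) (τ s)) with hy
  set u : ℂ → Fin n → ℂ := fun s => affineLift b
    ((monster n k).prolong.projAtlas.coord ((diagChart a k, a), b) (σ s)).2 with hu
  have hCd : ∀ c, HasDerivAt (C c) (h.cofAt c v.1) 0 := fun c =>
    (monsterFrame n k).prolong.prolong.hasDerivAt_cof_coord hvel hmem c
  have hua : (fun s => u s a) = C a := by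
    funext s
    exact (affineLift_of_ne h.ne _).trans
      (prolong_cof_of_ne (monster n k).prolong (diagChart a k, a) h.ne _).symm
  have hyb : y b =ᶠ[𝓝 0] C b := by
    filter_upwards [hσ.base_eq] with s hs
    have h1 := prolong_cof_self (monster n k).prolong (diagChart a k, a) b
      ((monster n k).prolong.projAtlas.coord ((diagChart a k, a), b) (σ s))
    refine Eq.trans ?_ h1.symm
    exact congrArg (fun q => (monster n k).prolong.cof (diagChart a k, a) b
      ((monster n k).projAtlas.coord (diagChart a k, a) q)) hs.symm
  have hyb0 : deriv (y b) 0 = h.cofAt b v.1 := by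
    rw [hyb.deriv_eq]
    exact (hCd b).deriv
  have hyan : AnalyticAt ℂ (y b) 0 :=
    (monsterFrame n k).prolong.analyticAt_cof_coord hσ.1 hτ0 b
  have hyd : ∀ c, deriv (y c) =ᶠ[𝓝 0] fun s => u s c * deriv (y b) s :=
    (monsterFrame n k).prolong.deriv_cof_eq hσ hmem
  have hu0a : u 0 a = 0 := h.dir_a
  have hξ : (fun s => γ s a) =ᶠ[𝓝 0] y a := by
    refine hX.base_eq.trans (Eventually.of_forall fun s => ?_)
    exact (cof_coord_diagChart a (τ s)).symm
  -- dx_a = u_a dy_b, where y_b is the b-th top derivative and u_a the affine coordinate vanishing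
  -- at p; hence the critical point of x_a.
  have hξd : deriv (fun s => γ s a) =ᶠ[𝓝 0] fun s => C a s * deriv (y b) s := by
    rw [← hua]
    exact hξ.deriv.trans (hyd a)
  have hCa : C a 0 = 0 := by
    rw [← hua]
    exact hu0a
  refine ⟨X, hX.zero_eq, ?_, hX.analyticAt, hX.deriv_eq, ⟨h.cofAt b v.1, hreg.1, ?_⟩, ?_, ?_⟩
  · rw [hX.one_eq (Nat.succ_pos k)]
    exact congrArg (firstDir a) hbase0.symm
  · funext c
    rw [(deriv_apply_of_analyticAt (hX.analyticAt _ le_rfl) c).self_of_nhds]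
    change _ = h.cofAt b v.1 * u 0 c
    by_cases hc : c = a
    · subst hc
      obtain ⟨x, hx⟩ := hX.top_base (Nat.succ_pos k)
      simp only [hx]
      rw [hu0a, mul_zero, deriv_const]
    · rw [(hX.top_eq c hc).deriv_eq]
      refine (hyd c).self_of_nhds.trans ?_
      beta_reduce
      rw [hyb0, mul_comm]
  · rw [hξd.self_of_nhds]
    beta_reduce
    rw [hCa, zero_mul]
  -- At 0 the second derivative of x_a is u_a' y_b', and regularity of the direction says that
  -- neither factor vanishes.
  · rw [hξd.deriv_eq]
    have := ((hCd a).mul hyan.deriv.differentiableAt.hasDerivAt).deriv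
    rw [hCa, zero_mul, add_zero, hyb0] at this
    refine fun h0 => mul_ne_zero hreg.2 hreg.1 (this.symm.trans h0)

end IsVerticalChart

/-! ### Construction of a member of Germ(p) -/

theorem Polynomial.exists_derivative_eq (Q : Polynomial ℂ) (x : ℂ) :
    ∃ R : Polynomial ℂ, Polynomial.derivative R = Q ∧ R.eval 0 = x := by
  have h : ∃ R : Polynomial ℂ, Polynomial.derivative R = Q := by
    induction Q using Polynomial.induction_on' with
    | add p q hp hq =>
      obtain ⟨P, rfl⟩ := hp
      obtain ⟨P', rfl⟩ := hq
      exact ⟨P + P', by simp⟩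
    | monomial m c =>
      refine ⟨Polynomial.monomial (m + 1) (c / (m + 1)), ?_⟩
      rw [Polynomial.derivative_monomial]
      congr 1
      push_cast
      exact div_mul_cancel₀ _ (Nat.cast_add_one_ne_zero m)
  obtain ⟨R, hR⟩ := h
  exact ⟨R + Polynomial.C (x - R.eval 0), by simp [hR], by simp⟩

/-- Repeated integration with respect to `s²`. -/
theorem exists_iterated_primitive (m : ℕ) (J : ℕ → Fin n → ℂ) (e : Fin n → ℂ) :
    ∃ X : ℕ → ℂ → Fin n → ℂ, (∀ j, Differentiable ℂ (X j)) ∧ (∀ j ≤ m, X j 0 = J j) ∧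
      (∀ s, X m s = J m + s • e) ∧ ∀ j < m, ∀ s, HasDerivAt (X j) ((2 * s) • X (j + 1) s) s := by
  -- Polynomials have global antiderivatives with prescribed value at 0, so the recursion is solved
  -- exactly on all of ℂ.
  suffices h : ∃ P : ℕ → Fin n → Polynomial ℂ, (∀ j ≤ m, ∀ c, (P j c).eval 0 = J j c) ∧
      (∀ c, P m c = Polynomial.C (J m c) + Polynomial.X * Polynomial.C (e c)) ∧
      ∀ j < m, ∀ c, Polynomial.derivative (P j c) = 2 * Polynomial.X * P (j + 1) c by
    obtain ⟨P, h0, hm, hd⟩ := h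
    refine ⟨fun j s c => (P j c).eval s, fun j => differentiable_pi.2 fun c =>
      (P j c).differentiable, fun j hj => funext fun c => h0 j hj c, fun s => funext fun c => ?_,
      fun j hj s => hasDerivAt_pi.2 fun c => ?_⟩
    · simp [hm]
      ring
    · have := (P j c).hasDerivAt s
      rw [hd j hj] at this
      simpa using this
  induction m generalizing J with
  | zero =>
    refine ⟨fun _ c => Polynomial.C (J 0 c) + Polynomial.X * Polynomial.C (e c), ?_,
      fun _ => rfl, fun j hj => absurd hj (Nat.not_lt_zero j)⟩
    intro j hj c
    obtain rfl := Nat.le_zero.1 hj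
    simp
  | succ m ih =>
    obtain ⟨P, h0, hm, hd⟩ := ih (fun j => J (j + 1))
    choose R hR hR0 using fun c =>
      Polynomial.exists_derivative_eq (2 * Polynomial.X * P 0 c) (J 0 c)
    refine ⟨fun j => Nat.casesOn j R P, ?_, hm, ?_⟩
    · rintro (_ | j) hj c
      exacts [hR0 c, h0 j (by omega) c]
    · rintro (_ | j) hj c
      exacts [hR c, hd j (by omega) c]

/-- The coordinate vector in `diagChart a` of the jet `J`. -/
def jetCoord (a : Fin n) (J : ℕ → Fin n → ℂ) : ∀ m, (monster n m).Model (diagChart a m)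
  | 0 => J 0
  | m + 1 => (jetCoord a J m, fun b : {b : Fin n // b ≠ a} => J (m + 1) b.1)

theorem jetCoord_congr (a : Fin n) {J J' : ℕ → Fin n → ℂ} {m : ℕ} (h : ∀ j ≤ m, J j = J' j) :
    jetCoord a J m = jetCoord a J' m := by
  induction m with
  | zero => exact h 0 le_rfl
  | succ m ih =>
    rw [jetCoord, jetCoord, ih fun j hj => h j (hj.trans (Nat.le_succ m)), h (m + 1) le_rfl]

/-- `jetCoord` forgets the a-th component in degrees j ≥ 1, so this component is free to be that of
the jet of x_a with respect to itself: 1, then 0. -/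
theorem exists_jetCoord_eq (a : Fin n) {m : ℕ} (y : (monster n m).Model (diagChart a m)) :
    ∃ J : ℕ → Fin n → ℂ, jetCoord a J m = y ∧ J 1 a = 1 ∧ ∀ j, J (j + 2) a = 0 := by
  induction m with
  | zero => exact ⟨fun j => if j = 0 then y else if j = 1 then 1 else 0, rfl, by simp, by simp⟩
  | succ m ih =>
    obtain ⟨x, u⟩ : (monster n m).Model (diagChart a m) × ({b : Fin n // b ≠ a} → ℂ) := y
    obtain ⟨J, hJ, h1, h2⟩ := ih x
    refine ⟨fun j => if j = m + 1 then fun b => if h : b = a then J (m + 1) a else u ⟨b, h⟩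
      else J j, Prod.ext ?_ ?_, ?_, ?_⟩
    · refine (jetCoord_congr a fun j hj => ?_).trans hJ
      rw [if_neg (by omega)]
    · funext b
      have hb : b.1 ≠ a := b.2
      simp [jetCoord, hb]
    · beta_reduce
      split_ifs with h
      · simp [← h, h1]
      · exact h1
    · intro j
      beta_reduce
      split_ifs with h
      · simp [← h, h2]
      · exact h2 j

section Lift

variable {a : Fin n} {K : ℕ} {X : ℕ → ℂ → Fin n → ℂ}

theorem analyticAt_jetCoord (hX : ∀ j, Differentiable ℂ (X j)) (m : ℕ) (s : ℂ) :
    AnalyticAt ℂ (fun s => jetCoord a (fun j => X j s) m) s := by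
  induction m with
  | zero => exact (hX 0).analyticAt s
  | succ m ih =>
    have h2 : AnalyticAt ℂ (fun s (b : {b : Fin n // b ≠ a}) => X (m + 1) s b.1) s :=
      analyticAt_pi_iff.2 fun b => analyticAt_pi_iff.1 ((hX (m + 1)).analyticAt s) b.1
    exact AnalyticAt.prod ih h2

theorem hasDerivAt_jetCoord_succ {m : ℕ} {s : ℂ} {x' : (monster n m).Model (diagChart a m)}
    {w : Fin n → ℂ} (h1 : HasDerivAt (fun s => jetCoord a (fun j => X j s) m) x' s)
    (h2 : HasDerivAt (X (m + 1)) w s) :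
    HasDerivAt (fun s => jetCoord a (fun j => X j s) (m + 1))
      ((x', fun b => w b.1) : (monster n m).Model (diagChart a m) × ({b : Fin n // b ≠ a} → ℂ)) s :=
  HasDerivAt.prodMk h1 (hasDerivAt_pi.2 fun b => hasDerivAt_pi.1 h2 b.1)

/-- The contact condition: the velocity of the jet is 2s times the frame vector whose affine
coordinates are the next derivatives. Only at level 0 is the a-th component a coordinate, which is
where `h1` enters. -/
theorem hasDerivAt_jetCoord
    (hd : ∀ j < K, ∀ s, HasDerivAt (X j) ((2 * s) • X (j + 1) s) s)
    (h1 : ∀ s, X 1 s a = 1) {m : ℕ} (hm : m < K) (s : ℂ) :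
    HasDerivAt (fun s => jetCoord a (fun j => X j s) m)
      ((2 * s) • (monsterFrame n m).E (diagChart a m) (jetCoord a (fun j => X j s) m)
        (affineLift a fun b => X (m + 1) s b.1)) s := by
  induction m with
  | zero =>
    have e : (affineLift a fun b => X 1 s b.1) = X 1 s := by
      funext c
      by_cases hc : c = a
      · rw [hc, affineLift_self, h1]
      · rw [affineLift_of_ne hc]
    change HasDerivAt (X 0) ((2 * s) • affineLift a fun b => X 1 s b.1) s
    rw [e]
    exact hd 0 hm s
  | succ m ih =>
    refine (hasDerivAt_jetCoord_succ (ih (by omega)) (hd (m + 1) hm s)).congr_deriv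
      (Prod.ext ?_ ?_)
    · change _ = (2 * s) • (affineLift a (fun b => X (m + 1 + 1) s b.1) a • _)
      rw [affineLift_self, one_smul]
      rfl
    · funext b
      have hb : b.1 ≠ a := b.2
      change _ = (2 * s) • (affineLift a (fun b => X (m + 1 + 1) s b.1) b.1)
      rw [affineLift_of_ne hb]
      rfl

/-- The curve in the Monster with the coordinates `X`. -/
noncomputable def jetLift (a : Fin n) (X : ℕ → ℂ → Fin n → ℂ) (m : ℕ) (s : ℂ) : MPt n m :=
  (monsterFrame n m).isManifold.point (diagChart a m) (jetCoord a (fun j => X j s) m)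

theorem jetLift_inDiag (m : ℕ) (s : ℂ) : (jetLift a X m s).InDiag a :=
  (monsterFrame n m).isManifold.point_mem _ _

theorem coord_jetLift (m : ℕ) (s : ℂ) :
    (monster n m).coord (diagChart a m) (jetLift a X m s) = jetCoord a (fun j => X j s) m :=
  (monsterFrame n m).isManifold.coord_point _ _

theorem jetLift_eq {m : ℕ} {s : ℂ} {q : MPt n m} (hq : q.InDiag a)
    (h : (monster n m).coord (diagChart a m) q = jetCoord a (fun j => X j s) m) :
    q = jetLift a X m s :=
  ((monsterFrame n m).isManifold.bijOn _).injOn hq (jetLift_inDiag m s)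
    (h.trans (coord_jetLift m s).symm)

theorem isIteratedProlongation_jetLift (hX : ∀ j, Differentiable ℂ (X j))
    (hd : ∀ j < K, ∀ s, HasDerivAt (X j) ((2 * s) • X (j + 1) s) s)
    (h1 : ∀ s, X 1 s a = 1) {m : ℕ} (hm : m ≤ K) :
    IsIteratedProlongation (X 0) m (jetLift a X m) := by
  induction m with
  | zero =>
    funext s
    exact coord_jetLift 0 s
  | succ m ih =>
    have hc : ∀ s, (monster n m).projAtlas.coord (diagChart a m, a) (jetLift a X (m + 1) s) =
      (jetCoord a (fun j => X j s) m, fun b => X (m + 1) s b.1) := fun s => coord_jetLift (m + 1) s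
    refine ⟨jetLift a X m, ih (by omega),
      (monsterFrame n m).isCurveProlongation_of_chart (i := diagChart a m) (a := a)
      (fun s => jetLift_inDiag (m + 1) s)
      (fun s => jetLift_eq (jetLift_inDiag (m + 1) s).1 (congrArg Prod.fst (hc s)))
      ((analyticAt_jetCoord hX (m + 1) 0).congr
        (Eventually.of_forall fun s => (coord_jetLift (m + 1) s).symm))
      (fun s => 2 * s) (fun s hs => mul_ne_zero two_ne_zero hs) fun s => ?_⟩
    rw [hc]
    have := hasDerivAt_jetCoord hd h1 (show m < K from hm) s
    simpa only [coord_jetLift] using this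

end Lift

/-- Downward induction on the degree: the top a-th component is constant as e_a = 0, and a component
of degree j ≥ 1 is constant because the next one equals J (j + 1) a = 0. -/
theorem isIteratedPrimitive_apply {a : Fin n} {K : ℕ} {X : ℕ → ℂ → Fin n → ℂ}
    {J : ℕ → Fin n → ℂ} {e : Fin n → ℂ} (h0 : ∀ j ≤ K + 1, X j 0 = J j)
    (htop : ∀ s, X (K + 1) s = J (K + 1) + s • e)
    (hd : ∀ j < K + 1, ∀ s, HasDerivAt (X j) ((2 * s) • X (j + 1) s) s) (hJ1 : J 1 a = 1)
    (hJ : ∀ j, J (j + 2) a = 0) (he : e a = 0) (s : ℂ) : X 1 s a = 1 := by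
  have key : ∀ i ≤ K, ∀ s, X (K + 1 - i) s a = J (K + 1 - i) a := by
    intro i
    induction i with
    | zero =>
      intro _ s
      simp [htop, he]
    | succ i ih =>
      intro hi s
      have hj : K + 1 - (i + 1) + 1 = K + 1 - i := by omega
      have h2 : J (K + 1 - i) a = 0 := by
        rw [show K + 1 - i = (K - i - 1) + 2 by omega]
        exact hJ _
      have h3 : ∀ s, HasDerivAt (fun s => X (K + 1 - (i + 1)) s a) 0 s := by
        intro s
        have := hasDerivAt_pi.1 (hd (K + 1 - (i + 1)) (by omega) s) a
        rw [hj, Pi.smul_apply, ih (by omega), h2, smul_zero] at this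
        exact this
      rw [← h0 _ (by omega)]
      exact is_const_of_deriv_eq_zero (fun s => (h3 s).differentiableAt) (fun s => (h3 s).deriv) s 0
  have := key K le_rfl s
  rwa [show K + 1 - K = 1 by omega, hJ1] at this

namespace IsVerticalChart

variable {k : ℕ} {p : MPt n (k + 2)} {a b : Fin n} (h : IsVerticalChart p a b)

include h in
-- The jets come from integrating a top derivative with velocity `h.dir`. At p the lifted curve has
-- dy_b = 1 and du_a = 2, so its direction lies in neither critical hyperplane.
theorem germ_nonempty (hp : ¬ p.down.IsCritical) : p.Germ.Nonempty := by
  obtain ⟨J, hJ, hJ1, hJ2⟩ := exists_jetCoord_eq a (m := k + 1)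
    ((monster n k).projAtlas.coord (diagChart a k, a) p.pair.base)
  obtain ⟨X, hXd, hX0, htop, hd⟩ := exists_iterated_primitive (k + 1) J h.dir
  have h1 := isIteratedPrimitive_apply hX0 htop hd hJ1 hJ2 h.dir_a
  have hprol := isIteratedProlongation_jetLift hXd hd h1 le_rfl
  -- The affine coordinates dy_c/dy_b and dx_a/dy_b of this curve: since y_b has velocity 1, they
  -- are the constants `h.dir c` and the derivative 2s of x_a.
  set u : ℂ → {c : Fin n // c ≠ b} → ℂ := fun s c => if c.1 = a then 2 * s else h.dir c.1 with hu
  set Y : ℂ → (monster n k).Model (diagChart a k) × ({c : Fin n // c ≠ a} → ℂ) :=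
    fun s => jetCoord a (fun j => X j s) (k + 1) with hY
  have hM := (monsterFrame n k).prolong.isManifold_proj
  set σ : ℂ → (monster n k).prolong.ProjPt := fun s =>
    hM.point ((diagChart a k, a), b) (Y s, u s) with hσ
  have hσm : ∀ s, σ s ∈ (monster n k).prolong.projAtlas.dom ((diagChart a k, a), b) := fun s =>
    hM.point_mem _ _
  have hσc : ∀ s, (monster n k).prolong.projAtlas.coord ((diagChart a k, a), b) (σ s) =
    (Y s, u s) := fun s => hM.coord_point _ _
  have hud : ∀ s, HasDerivAt u (fun c => if c.1 = a then 2 else 0) s := by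
    intro s
    refine hasDerivAt_pi.2 fun c => ?_
    simp only [hu]
    split_ifs
    · simpa using (hasDerivAt_id s).const_mul (2 : ℂ)
    · exact hasDerivAt_const _ _
  have htopd : ∀ s, HasDerivAt (X (k + 1)) h.dir s := by
    intro s
    rw [show X (k + 1) = fun s => J (k + 1) + s • h.dir from funext htop]
    simpa using ((hasDerivAt_id s).smul_const h.dir).const_add (J (k + 1))
  have hYd : ∀ s, HasDerivAt Y (prolongE (monsterFrame n k) (diagChart a k) a (Y s)
      (affineLift b (u s))) s := by
    intro s
    refine (hasDerivAt_jetCoord_succ (hasDerivAt_jetCoord hd h1 (Nat.lt_succ_self k) s)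
      (htopd s)).congr_deriv (Prod.ext ?_ ?_)
    · change _ = affineLift b (u s) a • _
      rw [affineLift_of_ne h.ne]
      simp only [hu, if_true]
      rfl
    · funext c
      have hca : c.1 ≠ a := c.2
      change h.dir c.1 = affineLift b (u s) c.1
      by_cases hcb : c.1 = b
      · rw [hcb, affineLift_self, h.dir_b]
      · rw [affineLift_of_ne hcb]
        simp only [hu, if_neg hca]
  have hcoord : (Y 0, u 0) =
      (monster n k).prolong.projAtlas.coord ((diagChart a k, a), b) p.pair := by
    refine Prod.ext ?_ ?_
    · exact (jetCoord_congr a fun j hj => hX0 j hj).trans hJ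
    · funext c
      have hcb : c.1 ≠ b := c.2
      by_cases hca : c.1 = a
      · obtain rfl : c = ⟨a, h.ne⟩ := Subtype.ext hca
        refine Eq.trans ?_ h.eq_zero.symm
        simp [hu]
      · refine Eq.trans ?_ (affineLift_of_ne hcb _)
        simp only [hu, if_neg hca]
        rfl
  set V : ((monster n k).Model (diagChart a k) × ({c : Fin n // c ≠ a} → ℂ)) ×
    ({c : Fin n // c ≠ b} → ℂ) := (prolongE (monsterFrame n k) (diagChart a k) a (Y 0)
      (affineLift b (u 0)), fun c => if c.1 = a then 2 else 0) with hV
  set v := hM.tangentOf h.mem V with hv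
  have hvV : v.1 ⟨_, h.mem⟩ = V := hM.tangentOf_apply h.mem V
  have hvd : v ∈ (monster n k).prolong.prolong.dist p.pair := by
    refine ((monsterFrame n k).prolong.mem_prolong_dist h.mem v).2 ⟨1, ?_⟩
    rw [hvV, one_smul, ← hcoord]
    have hY0 : (monster n k).prolong.coord (diagChart a k, a) p.pair.base = Y 0 :=
      (congrArg Prod.fst hcoord).symm
    rw [hY0]
    rfl
  have hva : h.cofAt a v = 2 := by
    rw [cofAt_eq, hvV]
    simp [hV]
  have hvb : h.cofAt b v = 1 := by
    refine (prolong_cof_self (monster n k).prolong (diagChart a k, a) b _).trans ?_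
    rw [hvV]
    exact ((monsterFrame n k).prolong.cof_E (diagChart a k, a) (Y 0) (affineLift b (u 0)) b).trans
      (affineLift_self b _)
  have hv0 : (⟨v, hvd⟩ : (monster n k).prolong.prolong.dist p.pair) ≠ 0 := by
    intro h0
    have h2 : v = 0 := congrArg Subtype.val h0
    have h3 := h.cofAt_smul 0 a v
    rw [zero_smul, zero_mul, ← h2, hva] at h3
    exact two_ne_zero h3
  refine ⟨X 0, (hXd 0).analyticAt 0, ?_, σ, ⟨jetLift a X (k + 1), hprol, ?_⟩, ⟨v, hvd⟩, hv0, ?_, ?_⟩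
  -- Non-constancy shows in the component a, whose derivative is 2s.
  · intro hc
    have h2 : ∀ᶠ s in 𝓝[≠] (0 : ℂ), False := by
      have h3 : deriv (X 0) =ᶠ[𝓝 0] fun _ => 0 :=
        (EventuallyEq.deriv (show X 0 =ᶠ[𝓝 0] fun _ => X 0 0 from hc)).trans
          (Eventually.of_forall fun s => deriv_const s _)
      filter_upwards [nhdsWithin_le_nhds h3, self_mem_nhdsWithin] with s hs hs0
      rw [(hd 0 (Nat.succ_pos k) s).deriv] at hs
      have h4 := congrFun hs a
      rw [Pi.smul_apply, zero_add, h1, smul_eq_mul, mul_one] at h4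
      exact mul_ne_zero two_ne_zero hs0 h4
    exact h2.exists.choose_spec
  · refine (monsterFrame n k).prolong.isCurveProlongation_of_chart hσm
      (fun s => jetLift_eq (m := k + 1) (hσm s).1 (congrArg Prod.fst (hσc s))) ?_ (fun _ => 1)
      (fun _ _ => one_ne_zero) fun s => ?_
    · refine AnalyticAt.congr ?_ (Eventually.of_forall fun s => (hσc s).symm)
      exact (analyticAt_jetCoord hXd (k + 1) 0).prod
        (Differentiable.analyticAt (fun s => (hud s).differentiableAt) 0)
    · rw [one_smul, hσc]
      have h2 : ∀ s, (monster n k).prolong.coord (diagChart a k, a) (jetLift a X (k + 1) s) =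
        Y s := fun s => coord_jetLift (k + 1) s
      exact ((hYd s).congr_deriv (congrArg (fun y => prolongE (monsterFrame n k) (diagChart a k) a y
        (affineLift b (u s))) (h2 s).symm)).congr_of_eventuallyEq (Eventually.of_forall h2)
  · refine hM.hasVelocityAt_point h.mem hcoord ?_
    rw [hvV]
    exact (hYd 0).prodMk (hud 0)
  · intro hcrit
    rcases (h.isCriticalDirection_iff hp).1 hcrit with h2 | h2
    · exact one_ne_zero (hvb.symm.trans h2)
    · exact two_ne_zero (hva.symm.trans h2)

end IsVerticalChart

/-! ### The flag of a point of type R^kV -/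

theorem basePoint_eq_of_isIteratedProlongation {γ : ℂ → Fin n → ℂ} {m : ℕ} {σ : ℂ → MPt n m}
    (h : IsIteratedProlongation γ m σ) : (σ 0).basePoint = γ 0 := by
  induction m with
  | zero => exact congrFun h 0
  | succ m ih =>
    obtain ⟨τ, hτ, hσ⟩ := h
    rw [← ih hτ]
    exact congrArg basePoint hσ.2.2.1

theorem MPt.Germ.basePoint_eq {m : ℕ} {p : MPt n m} {γ : ℂ → Fin n → ℂ} (h : γ ∈ p.Germ) :
    p.basePoint = γ 0 := by
  obtain ⟨-, -, σ, hσ, v, hv, hvel, -⟩ := h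
  rw [← hvel.1]
  exact basePoint_eq_of_isIteratedProlongation hσ

theorem exists_isVerticalChart {n k : ℕ} {p : MPt n (k + 2)}
    (hp : p.code = List.replicate (k + 1) RVT.R ++ [RVT.V]) : ∃ a b, IsVerticalChart p a b := by
  obtain ⟨h1, h2⟩ := code_eq_append hp
  obtain ⟨a, ha⟩ := exists_inDiag p.down h1
  have hz := (isVertical_iff ha).1 (lastLetter_eq_V h2)
  obtain ⟨b, hb⟩ := (monsterFrame n k).prolong.homCoord_ne_zero p.pair ⟨(diagChart a k, a), ha⟩
  have hab : a ≠ b := by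
    rintro rfl
    exact hb hz
  have hmem : p.pair ∈ (monster n k).prolong.projAtlas.dom ((diagChart a k, a), b) := ⟨ha, hb⟩
  exact ⟨a, b, hab, hmem, (Frame.coord_snd_eq_zero_iff hmem ⟨a, hab⟩).2 hz⟩

end

theorem mainTheorem10 (n k : ℕ) (p : MPt n (k + 1))
    (hp : p.code = List.replicate k RVT.R ++ [RVT.V]) :
    p.Germ.Nonempty ∧
    (∀ γ ∈ p.Germ, ∃ (S : Set (Fin n → ℂ)) (P : Submodule ℂ (Fin n → ℂ)),
      IsSmoothSurfaceAt S p.basePoint P ∧ ∀ᶠ t in 𝓝 (0 : ℂ), γ t ∈ S) ∧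
    ∃! F : Submodule ℂ (Fin n → ℂ) × Submodule ℂ (Fin n → ℂ),
      Module.finrank ℂ F.1 = 1 ∧ Module.finrank ℂ F.2 = 2 ∧ F.1 ≤ F.2 ∧
      F.1 = p.firstLine ∧
      ∀ γ ∈ p.Germ, IsTangentLine γ F.1 ∧
        ∀ (S : Set (Fin n → ℂ)) (P : Submodule ℂ (Fin n → ℂ)),
          IsSmoothSurfaceAt S p.basePoint P → (∀ᶠ t in 𝓝 (0 : ℂ), γ t ∈ S) → P = F.2 := by
  -- The code would be the single letter V, but level one has no vertical points.
  rcases k with _ | k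
  · exact (MPt.lastLetter_eq_V (MPt.code_eq_append hp).2).elim
  obtain ⟨a, b, h⟩ := exists_isVerticalChart hp
  have hcode := (MPt.code_eq_append hp).1
  rw [List.replicate_succ'] at hcode
  have hcrit := (MPt.lastLetter_eq_R (MPt.code_eq_append hcode).2).2
  have hne := h.germ_nonempty hcrit
  have hi := h.linearIndependent
  have hw : MPt.firstDir a p ≠ 0 := hi.ne_zero 0
  have hsurf : ∀ γ ∈ p.Germ, ∃ (S : Set (Fin n → ℂ)) (P : Submodule ℂ (Fin n → ℂ)),
      IsSmoothSurfaceAt S p.basePoint P ∧ ∀ᶠ t in 𝓝 (0 : ℂ), γ t ∈ S := by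
    intro γ hγ
    obtain ⟨X, hX⟩ := h.exists_isJetCurve hcrit hγ
    rw [MPt.Germ.basePoint_eq hγ]
    exact hX.exists_surface (Nat.succ_pos k) hi
  have hline : p.firstLine = Submodule.span ℂ {MPt.firstDir a p} := MPt.firstLine_eq_span p.down h.mem.1
  refine ⟨hne, hsurf, (Submodule.span ℂ {MPt.firstDir a p}, Submodule.span ℂ {MPt.firstDir a p, h.dir}),
    ⟨finrank_span_singleton hw, finrank_span_pair hi, Submodule.span_mono (by simp), hline.symm,
      fun γ hγ => ?_⟩, ?_⟩
  · obtain ⟨X, hX⟩ := h.exists_isJetCurve hcrit hγ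
    refine ⟨hX.isTangentLine (Nat.succ_pos k) hw, fun S P hS hmem => ?_⟩
    rw [MPt.Germ.basePoint_eq hγ] at hS
    exact hX.eq_span_of_surface (Nat.succ_pos k) hi hS hmem
  -- Any competing plane is the tangent plane of one actual surface through one actual germ, and
  -- that plane is already known.
  · rintro ⟨L, P'⟩ ⟨-, -, -, hL, hall⟩
    obtain ⟨γ, hγ⟩ := hne
    obtain ⟨S, P, hS, hmem⟩ := hsurf γ hγ
    obtain ⟨X, hX⟩ := h.exists_isJetCurve hcrit hγ
    have h1 := (hall γ hγ).2 S P hS hmem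
    rw [MPt.Germ.basePoint_eq hγ] at hS
    exact Prod.ext (hL.trans hline) (h1.symm.trans
      (hX.eq_span_of_surface (Nat.succ_pos k) hi hS hmem))
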